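/- For $k,x\in\mathbf C$ and $q\in\mathbf C$ with $0<|q|<1$, write $q^s=\exp(s\,\mathrm{Log}\,q)$ (principal logarithm; for $0<q<1$ this is the real one), and put $$\delta(x;q,k)=\prod_{j=0}^\infty\frac{(1-q^{j+2x})(1-q^{j-2x})}{(1-q^{j+k+2x})(1-q^{j+k-2x})},\qquad \mu(x;q,k)=\prod_{j=0}^\infty\frac{(1-q^{j+2x})(1-q^{j+1-2x})}{(1-q^{j+k+2x})(1-q^{j+k+1-2x})}.$$ **(i)** Let $0<q<1$, $q=e^{-1/a}$ with $a>0$, and $\Re k>0$. Then $q^{-x^2}\delta(x;q,k)$ is integrable on the imaginary axis and $$(-i)\int_{-\infty i}^{\infty i}q^{-x^2}\,\delta(x;q,k)\,dx=2\sqrt{a\pi}\,\prod_{j=0}^\infty\frac{1-q^{j+k}}{1-q^{j+2k}}.$$ **(ii)** Let $0<|q|<1$ and $|q^{1+2k}|<1$ (for $0<q<1$ this says $\Re k>-1/2$). Replace $q^{-x^2}$ by the series $\tilde\gamma^{-1}=\sum_{n\in\mathbf Z}q^{n^2/4}q^{nx}$, and let $\langle q^{-x^2}\rangle_\circ$ be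 the constant term $c_0$ of the Laurent expansion $\tilde\gamma^{-1}\mu(x;q,k)=\sum_{n\in\mathbf Z}c_nq^{nx}$ in the region $|q^{k+2x}|<1$, $|q^{k+1-2x}|<1$. This expansion exists, and $$\langle q^{-x^2}\rangle_\circ=\prod_{j=1}^\infty\frac{1-q^{j+k}}{1-q^{j+2k}}.$$ For $0<q<1$ and $k\in\mathbf C$ let $$\langle f\rangle_\bullet=\sum_{j=0}^\infty q^{-kj}\,\frac{1-q^{j+k}}{1-q^k}\prod_{l=1}^j\frac{1-q^{l+2k-1}}{1-q^l}\;f\!\left(\frac{k+j}2\right),$$ where the denominator $1-q^k$ is cancelled for $j\ge 1$ against the factor $1-q^{2k}=(1-q^k)(1+q^k)$ and the term with $j=0$ is $f(k/2)$, so that the terms make sense also when $q^k=1$. **(iii)** Let $0<q<1$, $q=e^{-1/a}$ with $a>0$, $\Re k>0$, $\epsilon>0$, $|\Im k|<2\epsilon$, and let $\epsilon$ be small in the sense that $|\Im k|+2\epsilon<2\pi a$. Let $\int_\sharp$ be the integration along the path that comes from $\epsilon i+\infty$ to the left to $\epsilon i$, goes down through the origin to $-\epsilon i$, and returns to the right to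 $-\epsilon i+\infty$. Then $q^{x^2}\delta(x;q,k)$ is integrable along this path and $$\frac1{2i}\int_\sharp q^{x^2}\,\delta(x;q,k)\,dx=-\frac{a\pi}2\prod_{j=0}^\infty\frac{(1-q^{j+k})(1-q^{j-k})}{(1-q^{j+2k})(1-q^{j+1})}\;\langle q^{x^2}\rangle_\bullet.$$ **(iv)** Let $0<q<1$ and $k\in\mathbf C$. Then the series below converge absolutely and $$\langle q^{x^2}\rangle_\bullet=\prod_{j=1}^\infty\frac{1-q^{j+k}}{1-q^j}\sum_{j=-\infty}^\infty q^{(k+j)^2/4} =q^{k^2/4}\prod_{j=1}^\infty\frac{(1-q^{j/2})(1-q^{j+k})(1+q^{j/2-1/4+k/2})(1+q^{j/2-1/4-k/2})}{1-q^j}.$$ -/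

import Mathlib

/-- The kernel
`δ(x; q, k) = ∏_{j ≥ 0} (1 - q^{j+2x}) (1 - q^{j-2x}) / ((1 - q^{j+k+2x}) (1 - q^{j+k-2x}))`. -/
noncomputable def qDelta (q k x : ℂ) : ℂ :=
  ∏' j : ℕ, ((1 - q ^ ((j : ℂ) + 2 * x)) * (1 - q ^ ((j : ℂ) - 2 * x))) /
    ((1 - q ^ ((j : ℂ) + k + 2 * x)) * (1 - q ^ ((j : ℂ) + k - 2 * x)))

/-- The kernel
`μ(x; q, k) = ∏_{j ≥ 0} (1 - q^{j+2x}) (1 - q^{j+1-2x}) / ((1 - q^{j+k+2x}) (1 - q^{j+k+1-2x}))`. -/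
noncomputable def qMu (q k x : ℂ) : ℂ :=
  ∏' j : ℕ, ((1 - q ^ ((j : ℂ) + 2 * x)) * (1 - q ^ ((j : ℂ) + 1 - 2 * x))) /
    ((1 - q ^ ((j : ℂ) + k + 2 * x)) * (1 - q ^ ((j : ℂ) + k + 1 - 2 * x)))

/-- The integral `∫_{-∞ i}^{∞ i} f dx` along the imaginary axis, parametrized by `x = y i`. -/
noncomputable def imaginaryIntegral (f : ℂ → ℂ) : ℂ :=
  ∫ y : ℝ, f (y * Complex.I) * Complex.I

/-- The integral of `f` along the contour that comes from `ε i + ∞` to the left to `ε i`, goes down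
through the origin to `-ε i`, and returns to the right to `-ε i + ∞`. -/
noncomputable def sharpIntegral (ε : ℝ) (f : ℂ → ℂ) : ℂ :=
  -(∫ t in Set.Ioi (0 : ℝ), f (t + ε * Complex.I))
    + (∫ s in (-ε)..ε, f (-s * Complex.I) * (-Complex.I))
    + ∫ t in Set.Ioi (0 : ℝ), f (t - ε * Complex.I)

/-- `f` is integrable along each of the three pieces of the contour of `sharpIntegral`. -/
def SharpIntegrable (ε : ℝ) (f : ℂ → ℂ) : Prop :=
  MeasureTheory.IntegrableOn (fun t : ℝ => f (t + ε * Complex.I)) (Set.Ioi 0) ∧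
  IntervalIntegrable (fun s : ℝ => f (-s * Complex.I) * (-Complex.I)) MeasureTheory.volume (-ε) ε ∧
  MeasureTheory.IntegrableOn (fun t : ℝ => f (t - ε * Complex.I)) (Set.Ioi 0)

/-- `f(x) = ∑_{n ∈ ℤ} c_n q^{n x}` for all `x ∈ D`. -/
def IsLaurentExpansion (q : ℂ) (D : Set ℂ) (f : ℂ → ℂ) (c : ℤ → ℂ) : Prop :=
  ∀ x ∈ D, HasSum (fun n : ℤ => c n * q ^ ((n : ℂ) * x)) (f x)

/-- `f` has a Laurent expansion `∑ c_n q^{n x}` on `D`, and its constant term `c_0` is `v`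
(for every such expansion, so that `v` is determined by `f` and `D`). -/
def HasConstTerm (q : ℂ) (D : Set ℂ) (f : ℂ → ℂ) (v : ℂ) : Prop :=
  (∃ c, IsLaurentExpansion q D f c) ∧ ∀ c, IsLaurentExpansion q D f c → c 0 = v

/-- In terms of `X = q^x`, this is the annulus `|q^{k+1}| < |X|^2 < |q^{-k}|`, in which the
factors `1 / (1 - q^{j+k} X^2)` and `1 / (1 - q^{j+k+1} X^{-2})` of `μ` are expanded
as geometric series. -/
def muDomain (q k : ℂ) : Set ℂ :=
  {x | ‖q ^ (k + 2 * x)‖ < 1 ∧ ‖q ^ (k + 1 - 2 * x)‖ < 1}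

/-- The Laurent series `∑_{n ∈ ℤ} q^{n^2/4} q^{n x}` that replaces `q^{-x^2}`. -/
noncomputable def invGaussSeries (q x : ℂ) : ℂ :=
  ∑' n : ℤ, q ^ ((n : ℂ) ^ 2 / 4) * q ^ ((n : ℂ) * x)

/-- The weight
`q^{-kj} (1 - q^{j+k}) / (1 - q^k) ∏_{l=1}^{j} (1 - q^{l+2k-1}) / (1 - q^l)`,
in which the denominator `1 - q^k` has been cancelled against the factor
`1 - q^{2k} = (1 - q^k) (1 + q^k)` for `l = 1`, so that it makes sense for all `k`;
see `jacksonWeight_eq`. -/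
noncomputable def jacksonWeight (q k : ℂ) : ℕ → ℂ
  | 0 => 1
  | (j + 1) => q ^ (-k * ((j + 1 : ℕ) : ℂ)) * (1 - q ^ (((j + 1 : ℕ) : ℂ) + k)) *
      ((1 + q ^ k) / (1 - q)) *
      ∏ l ∈ Finset.Icc 2 (j + 1), (1 - q ^ ((l : ℂ) + 2 * k - 1)) / (1 - q ^ l)

theorem jacksonWeight_eq (q k : ℂ) (hk : q ^ k ≠ 1) (j : ℕ) :
    jacksonWeight q k j = q ^ (-k * (j : ℂ)) * ((1 - q ^ ((j : ℂ) + k)) / (1 - q ^ k)) *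
      ∏ l ∈ Finset.Icc 1 j, (1 - q ^ ((l : ℂ) + 2 * k - 1)) / (1 - q ^ l) := by
  have h : 1 - q ^ k ≠ 0 := sub_ne_zero.2 (Ne.symm hk)
  cases j with
  | zero => simp [jacksonWeight, div_self h]
  | succ j =>
    have e : q ^ ((1 : ℕ) + 2 * k - 1 : ℂ) = q ^ k * q ^ k := by
      rw [show ((1 : ℕ) + 2 * k - 1 : ℂ) = (2 : ℕ) * k by push_cast; ring,
        Complex.cpow_nat_mul, pow_two]
    rw [jacksonWeight, ← Finset.mul_prod_Ioc_eq_prod_Icc (a := 1) (by omega),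
      show Finset.Ioc 1 (j + 1) = Finset.Icc 2 (j + 1) from rfl, e, pow_one]
    have e2 : (1 + q ^ k) = (1 - q ^ k * q ^ k) / (1 - q ^ k) := by
      field_simp; ring
    rw [e2]
    simp only [div_eq_mul_inv]
    ring

/-- The Jackson-type sum `⟨f⟩_•`, the sum of `f((k+j)/2)` over `j ≥ 0` with the above weights. -/
noncomputable def jacksonSum (q k : ℂ) (f : ℂ → ℂ) : ℂ :=
  ∑' j : ℕ, jacksonWeight q k j * f ((k + j) / 2)

theorem jacksonSum_gauss_eq (q k : ℂ) (hq : q ≠ 0) (hk : q ^ k ≠ 1) :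
    jacksonSum q k (fun x => q ^ (x ^ 2)) =
      ∑' j : ℕ, q ^ ((k - j) ^ 2 / 4) * ((1 - q ^ ((j : ℂ) + k)) / (1 - q ^ k)) *
        ∏ l ∈ Finset.Icc 1 j, (1 - q ^ ((l : ℂ) + 2 * k - 1)) / (1 - q ^ l) := by
  refine tsum_congr fun j => ?_
  rw [jacksonWeight_eq q k hk,
    show (k - (j : ℂ)) ^ 2 / 4 = -k * (j : ℂ) + ((k + (j : ℂ)) / 2) ^ 2 by ring, Complex.cpow_add (-k * (j : ℂ)) _ hq]
  ring

/-! Write t = q^k, z = q^{2x} and (a)_∞ = `qPoch q a`.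

Parts (i) and (ii) rest on the Laurent expansion of μ in powers of z, a case of Ramanujan's ₁ψ₁ sum
whose coefficients are proportional to A_n(t) = `psiCoeff q t n`. The relation `psiCoeff_contiguous`
expresses A_n(tq) through A_{n-1}, A_n, A_{n+1} at t. Summed against z^n, it says that ∑ A_n(t) z^n
changes by explicit factors when t becomes tq. Iteration drives t to 0, and the limit no longer
depends on t. At t = 1 only A_0 survives, which evaluates the limit: this is the Jacobi triple
product, and then ₁ψ₁ follows (`hasSum_psiCoeff`). Summed against q^{n²}, the same relation gives
M(tq) = (1 - tq) M(t) for M(t) = ∑ A_n(t) q^{n²}, and the same iteration yields M(t) = (q)_∞ /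
(tq)_∞ (`psiMoment_zero`).

Both parts reduce to M. In (ii) the constant term pairs z^m with q^{(2m)²/4} = q^{m²}. In (i) δ is
(1 + t)^{-1} times the symmetrization of μ under z ↦ 1/z, and on the imaginary axis the Gaussian
integrates z^n to √(aπ) q^{n²}.

For (iv), the weights times q^{x²} have the form q^{(k-j)²/4} W_j(t). A telescoping certificate
gives J(k) = (1 - q^{k+1}) J(k+1) for their sum J (`jacksonGauss_eq_mul`). As N → ∞, J(k+N),
recentred by N, tends to the full theta series divided by (q)_∞. The triple product in base q^{1/2}
turns that series into the product.

For (iii), the poles of the integrand in the half-strip are simple and lie at (k+n)/2. Their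
residues are a common constant times the terms of the Jackson sum (`gaussDeltaReg_at_pole`). The
integrand decays geometrically under x ↦ x + 1/2, so the far side of a growing rectangle contributes
nothing in the limit, and the sharp contour integral is the sum of all residues. -/

open Filter Topology

/-! ### Infinite q-Pochhammer symbols, and the kernels as quotients of them. -/

/-- The infinite `q`-Pochhammer symbol `(a; q)_∞ = ∏_{j ≥ 0} (1 - a q^j)`. -/
noncomputable def qPoch (q a : ℂ) : ℂ := ∏' j : ℕ, (1 - a * q ^ j)

theorem summable_norm_mul_pow {q : ℂ} (hq : ‖q‖ < 1) (a : ℂ) :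
    Summable fun j : ℕ => ‖-(a * q ^ j)‖ := by
  simp only [norm_neg, norm_mul, norm_pow]
  exact (summable_geometric_of_lt_one (norm_nonneg _) hq).mul_left _

theorem multipliable_qPoch {q : ℂ} (hq : ‖q‖ < 1) (a : ℂ) :
    Multipliable fun j : ℕ => 1 - a * q ^ j := by
  simpa [sub_eq_add_neg] using multipliable_one_add_of_summable (summable_norm_mul_pow hq a)

theorem hasProd_qPoch {q : ℂ} (hq : ‖q‖ < 1) (a : ℂ) :
    HasProd (fun j : ℕ => 1 - a * q ^ j) (qPoch q a) :=
  (multipliable_qPoch hq a).hasProd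

theorem qPoch_ne_zero {q : ℂ} (hq : ‖q‖ < 1) {a : ℂ} (ha : ∀ j : ℕ, a * q ^ j ≠ 1) :
    qPoch q a ≠ 0 := by
  have := tprod_one_add_ne_zero_of_summable (f := fun j : ℕ => -(a * q ^ j))
    (fun j => by rw [← sub_eq_add_neg]; exact sub_ne_zero.2 (ha j).symm) (summable_norm_mul_pow hq a)
  simpa [qPoch, sub_eq_add_neg] using this

theorem qPoch_ne_zero_of_norm_lt_one {q : ℂ} (hq : ‖q‖ < 1) {a : ℂ} (ha : ‖a‖ < 1) :
    qPoch q a ≠ 0 := by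
  refine qPoch_ne_zero hq fun j h => ?_
  have h1 : ‖a * q ^ j‖ < 1 := by
    rw [norm_mul, norm_pow]
    exact mul_lt_one_of_nonneg_of_lt_one_left (norm_nonneg _) ha
      (pow_le_one₀ (norm_nonneg _) hq.le)
  rw [h] at h1
  simp at h1

theorem qPoch_succ {q : ℂ} (hq : ‖q‖ < 1) (a : ℂ) :
    qPoch q a = (1 - a) * qPoch q (a * q) := by
  have h : Tendsto (fun n => ∏ j ∈ Finset.range (n + 1), (1 - a * q ^ j)) atTop
      (𝓝 ((1 - a) * qPoch q (a * q))) := by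
    simp only [Finset.prod_range_succ']
    have := (hasProd_qPoch hq (a * q)).tendsto_prod_nat.const_mul (1 - a)
    refine this.congr fun n => ?_
    rw [mul_comm]
    simp [pow_succ', mul_assoc]
  exact tendsto_nhds_unique
    ((hasProd_qPoch hq a).tendsto_prod_nat.comp (tendsto_add_atTop_nat 1)) h

theorem qPoch_eq_prod_mul {q : ℂ} (hq : ‖q‖ < 1) (a : ℂ) (n : ℕ) :
    qPoch q a = (∏ j ∈ Finset.range n, (1 - a * q ^ j)) * qPoch q (a * q ^ n) := by
  induction n with
  | zero => simp
  | succ n ih => rw [ih, Finset.prod_range_succ, qPoch_succ hq (a * q ^ n), pow_succ]; ring_nf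

theorem differentiable_qPoch {q : ℂ} (hq : ‖q‖ < 1) : Differentiable ℂ (qPoch q) := by
  intro a
  have hd : DifferentiableOn ℂ (fun a => ∏' j : ℕ, (1 + -(a * q ^ j)))
      (Metric.ball (0 : ℂ) (‖a‖ + 1)) := by
    have hs : Summable fun j : ℕ => (‖a‖ + 1) * ‖q‖ ^ j :=
      (summable_geometric_of_lt_one (norm_nonneg _) hq).mul_left _
    refine (Summable.hasProdLocallyUniformlyOn_nat_one_add (f := fun (j : ℕ) a => -(a * q ^ j))
      Metric.isOpen_ball hs (.of_forall fun n x hx => ?_)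
      (fun _ => by fun_prop)).differentiableOn
      (.of_forall fun s => ?_) Metric.isOpen_ball
    · rw [norm_neg, norm_mul, norm_pow]
      have : ‖x‖ < ‖a‖ + 1 := by simpa using hx
      gcongr
    · simpa [Finset.prod_fn] using
        DifferentiableOn.finsetProd (fun _ _ => by fun_prop)
  have h2 : qPoch q = fun a => ∏' j : ℕ, (1 + -(a * q ^ j)) := by
    ext a; simp [qPoch, sub_eq_add_neg]
  rw [h2]
  exact hd.differentiableAt (Metric.isOpen_ball.mem_nhds (by simp))

@[simp] theorem qPoch_zero (q : ℂ) : qPoch q 0 = 1 := by simp [qPoch]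

theorem exists_mul_pow_eq_one_of_qPoch_eq_zero {q : ℂ} (hq : ‖q‖ < 1) {a : ℂ}
    (h : qPoch q a = 0) : ∃ j : ℕ, a * q ^ j = 1 := by
  by_contra! h'
  exact qPoch_ne_zero hq h' h

/-- The denominator may vanish: then some factor has denominator 0 and is itself 0 by the convention
for division, so both sides are 0. Hence `qDelta_eq` and `qMu_eq` hold at the poles too. -/
theorem tprod_four_div {q : ℂ} (hq : ‖q‖ < 1) (a b c d : ℂ) :
    ∏' j : ℕ, ((1 - a * q ^ j) * (1 - b * q ^ j)) / ((1 - c * q ^ j) * (1 - d * q ^ j)) =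
      (qPoch q a * qPoch q b) / (qPoch q c * qPoch q d) := by
  by_cases hcd : qPoch q c * qPoch q d = 0
  · rw [hcd, div_zero]
    refine tprod_of_exists_eq_zero ?_
    rcases mul_eq_zero.1 hcd with h | h <;>
    · obtain ⟨j, hj⟩ := exists_mul_pow_eq_one_of_qPoch_eq_zero hq h
      exact ⟨j, by simp [hj]⟩
  have := (((hasProd_qPoch hq a).mul (hasProd_qPoch hq b)).mul
    (((hasProd_qPoch hq c).mul (hasProd_qPoch hq d)).inv₀ hcd)).tprod_eq
  simpa [div_eq_mul_inv] using this

theorem tprod_two_div {q : ℂ} (hq : ‖q‖ < 1) {a c : ℂ} (hc : qPoch q c ≠ 0) :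
    ∏' j : ℕ, (1 - a * q ^ j) / (1 - c * q ^ j) = qPoch q a / qPoch q c := by
  have := ((hasProd_qPoch hq a).mul ((hasProd_qPoch hq c).inv₀ hc)).tprod_eq
  simpa [div_eq_mul_inv] using this

theorem cpow_natCast_add {q : ℂ} (hq : q ≠ 0) (j : ℕ) (s : ℂ) :
    q ^ ((j : ℂ) + s) = q ^ s * q ^ j := by
  rw [Complex.cpow_add _ _ hq, Complex.cpow_natCast, mul_comm]

theorem qDelta_eq {q : ℂ} (hq0 : q ≠ 0) (hq : ‖q‖ < 1) (k x : ℂ) :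
    qDelta q k x = (qPoch q (q ^ (2 * x)) * qPoch q (q ^ (-2 * x))) /
      (qPoch q (q ^ (k + 2 * x)) * qPoch q (q ^ (k - 2 * x))) := by
  rw [← tprod_four_div hq, qDelta]
  refine tprod_congr fun j => ?_
  rw [← cpow_natCast_add hq0, ← cpow_natCast_add hq0, ← cpow_natCast_add hq0,
    ← cpow_natCast_add hq0]
  ring_nf

theorem qMu_eq {q : ℂ} (hq0 : q ≠ 0) (hq : ‖q‖ < 1) (k x : ℂ) :
    qMu q k x = (qPoch q (q ^ (2 * x)) * qPoch q (q ^ (1 - 2 * x))) /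
      (qPoch q (q ^ (k + 2 * x)) * qPoch q (q ^ (k + 1 - 2 * x))) := by
  rw [← tprod_four_div hq, qMu]
  refine tprod_congr fun j => ?_
  rw [← cpow_natCast_add hq0, ← cpow_natCast_add hq0, ← cpow_natCast_add hq0,
    ← cpow_natCast_add hq0]
  ring_nf

/-! ### The ₁ψ₁ coefficients and their contiguous relations. -/

/-- The finite product `∏_{i < n} (t - q^i) / (1 - t q^{i+1})`, i.e. `t^n (1/t)_n / (tq)_n`. -/
noncomputable def psiNat (q t : ℂ) (n : ℕ) : ℂ :=
  ∏ i ∈ Finset.range n, (t - q ^ i) / (1 - t * q ^ (i + 1))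

/-- The coefficients `t^n (1/t)_n / (tq)_n`, `n ∈ ℤ`, of Ramanujan's `₁ψ₁` series for `μ`. -/
noncomputable def psiCoeff (q t : ℂ) : ℤ → ℂ
  | Int.ofNat n => psiNat q t n
  | Int.negSucc n => q ^ (n + 1) * psiNat q t (n + 1)

@[simp] theorem psiNat_zero (q t : ℂ) : psiNat q t 0 = 1 := by simp [psiNat]

theorem psiNat_succ (q t : ℂ) (n : ℕ) :
    psiNat q t (n + 1) = psiNat q t n * ((t - q ^ n) / (1 - t * q ^ (n + 1))) :=
  Finset.prod_range_succ _ _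

@[simp] theorem psiCoeff_natCast (q t : ℂ) (n : ℕ) : psiCoeff q t n = psiNat q t n := rfl

@[simp] theorem psiCoeff_zero (q t : ℂ) : psiCoeff q t 0 = 1 := psiNat_zero q t

@[simp] theorem psiCoeff_neg_natCast (q t : ℂ) (n : ℕ) :
    psiCoeff q t (-n) = q ^ n * psiNat q t n := by
  cases n with
  | zero => simp
  | succ n => rfl

theorem psiCoeff_neg {q : ℂ} (hq : q ≠ 0) (t : ℂ) (n : ℤ) :
    psiCoeff q t (-n) = q ^ n * psiCoeff q t n := by
  obtain ⟨m, rfl | rfl⟩ := n.eq_nat_or_neg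
  · simp
  · simp [hq]

theorem psiCoeff_add_one {q t : ℂ} (hq : q ≠ 0) (ht : ∀ j : ℕ, 1 - t * q ^ (j + 1) ≠ 0) (n : ℤ) :
    psiCoeff q t (n + 1) * (1 - t * q ^ (n + 1)) = psiCoeff q t n * (t - q ^ n) := by
  obtain ⟨m, rfl | rfl⟩ := n.eq_nat_or_neg
  · have h := ht m
    rw [← Nat.cast_succ, psiCoeff_natCast, psiCoeff_natCast, zpow_natCast, zpow_natCast,
      Nat.succ_eq_add_one, psiNat_succ]
    field_simp
  · cases m with
    | zero =>
      have h := ht 0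
      simp only [zero_add, pow_one] at h
      simpa [psiNat_succ] using by
        have := psiNat_succ q t 0
        rw [show psiCoeff q t 1 = psiNat q t 1 from rfl, this]
        simp
        field_simp
    | succ m =>
      have h := ht m
      rw [show -((m + 1 : ℕ) : ℤ) + 1 = -(m : ℤ) by push_cast; ring, psiCoeff_neg_natCast,
        psiCoeff_neg_natCast, psiNat_succ, zpow_neg, zpow_neg, zpow_natCast, zpow_natCast]
      field_simp
      ring

/-- Since tq - q^{i+1} = q (t - q^i), the products at tq and at t agree up to a power of q and the
factors at the two ends. -/
theorem psiNat_mul_q {q t : ℂ} (ht : ∀ j : ℕ, 1 - t * q ^ (j + 1) ≠ 0) (n : ℕ) :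
    psiNat q (t * q) (n + 1) * (1 - t * q ^ (n + 2)) * (1 - t * q ^ (n + 1)) =
      -(q ^ n * (1 - t * q) ^ 2 * psiNat q t n) := by
  have h' : ∀ j : ℕ, 1 - t * q * q ^ (j + 1) ≠ 0 := fun j => by
    rw [mul_assoc, ← pow_succ']; exact ht (j + 1)
  induction n with
  | zero =>
    have h1 := ht 1
    have h2 := ht 0
    simp only [zero_add, pow_one, one_add_one_eq_two] at h1 h2
    rw [psiNat_succ]
    simp only [psiNat_zero, pow_zero, zero_add, pow_one, mul_assoc t q q, ← pow_two]
    field_simp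
    ring
  | succ n ih =>
    have h1 := h' (n + 1)
    have h2 := ht n
    have h3 := ht (n + 1)
    rw [psiNat_succ q (t * q), psiNat_succ q t]
    have e : 1 - t * q * q ^ (n + 1 + 1) = 1 - t * q ^ (n + 1 + 2) := by ring
    rw [e] at h1 ⊢
    have ih' : psiNat q (t * q) (n + 1) = -(q ^ n * (1 - t * q) ^ 2 * psiNat q t n) /
        ((1 - t * q ^ (n + 1 + 1)) * (1 - t * q ^ (n + 1))) := by
      rw [← ih]; field_simp
    rw [ih']
    field_simp
    ring

/-- The bracket is the nth coefficient of (1 - tz)(1 - tq/z) ∑ A_n z^n. For n ≥ 0 all terms are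
rational multiples of a single `psiNat`; the relation for -n is q^n times the one for n, by
`psiCoeff_neg`. -/
theorem psiCoeff_contiguous {q t : ℂ} (hq : q ≠ 0) (ht : ∀ j : ℕ, 1 - t * q ^ (j + 1) ≠ 0)
    (n : ℤ) :
    (1 - t * q) * ((1 + t ^ 2 * q) * psiCoeff q t n - t * psiCoeff q t (n - 1) -
      t * q * psiCoeff q t (n + 1)) = (1 + t * q) * (1 - t ^ 2 * q) * psiCoeff q (t * q) n := by
  have key : ∀ m : ℕ, (1 - t * q) * ((1 + t ^ 2 * q) * psiCoeff q t m -
      t * psiCoeff q t (m - 1) - t * q * psiCoeff q t (m + 1)) =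
        (1 + t * q) * (1 - t ^ 2 * q) * psiCoeff q (t * q) m := by
    intro m
    cases m with
    | zero =>
      have h := ht 0
      have e1 := psiCoeff_neg hq t 1
      have e2 := psiNat_succ q t 0
      have e3 : psiCoeff q t 1 = psiNat q t 1 := rfl
      simp only [zero_add, pow_one, psiNat_zero, pow_zero] at h e2
      simp only [Nat.cast_zero, zero_sub, zero_add, psiCoeff_zero]
      rw [e1, e3, e2]
      simp only [zpow_one]
      field_simp
      ring
    | succ m =>
      have h0 := ht m
      have h1 := ht (m + 1)
      have e0 : ((m + 1 : ℕ) : ℤ) - 1 = (m : ℤ) := by push_cast; ring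
      have e1 : ((m + 1 : ℕ) : ℤ) + 1 = ((m + 2 : ℕ) : ℤ) := by push_cast; ring
      have e2 : psiNat q (t * q) (m + 1) = -(q ^ m * (1 - t * q) ^ 2 * psiNat q t m) /
          ((1 - t * q ^ (m + 1 + 1)) * (1 - t * q ^ (m + 1))) := by
        rw [← psiNat_mul_q ht]; field_simp
      rw [e0, e1, psiCoeff_natCast, psiCoeff_natCast, psiCoeff_natCast, psiCoeff_natCast, e2,
        psiNat_succ q t (m + 1), psiNat_succ q t m]
      field_simp
      ring
  obtain ⟨m, rfl | rfl⟩ := n.eq_nat_or_neg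
  · exact key m
  · have h := key m
    have e1 : psiCoeff q t (-(m : ℤ) - 1) = q ^ ((m : ℤ) + 1) * psiCoeff q t (m + 1) := by
      rw [← psiCoeff_neg hq]; ring_nf
    have e2 : psiCoeff q t (-(m : ℤ) + 1) = q ^ ((m : ℤ) - 1) * psiCoeff q t (m - 1) := by
      rw [← psiCoeff_neg hq]; ring_nf
    rw [e1, e2, psiCoeff_neg hq, psiCoeff_neg hq, zpow_add₀ hq, zpow_sub₀ hq, zpow_one]
    field_simp
    linear_combination h

/-- At t = 1 every series in the A_n collapses to its term n = 0. This fixes the constants that the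
limits t q^N → 0 leave undetermined. -/
theorem psiCoeff_one {q : ℂ} (n : ℤ) (hn : n ≠ 0) : psiCoeff q 1 n = 0 := by
  have key : ∀ m : ℕ, psiNat q 1 (m + 1) = 0 := fun m =>
    Finset.prod_eq_zero (i := 0) (by simp) (by simp)
  obtain ⟨m, rfl | rfl⟩ := n.eq_nat_or_neg <;> cases m with
  | zero => simp at hn
  | succ m => simp only [psiCoeff_neg_natCast, psiCoeff_natCast, key, mul_zero]

/-! ### Summability, and domination uniform in N. -/

theorem summable_of_ratio_tendsto {u r : ℕ → ℂ} {l : ℂ} (hu : ∀ n, u (n + 1) = u n * r n)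
    (hr : Tendsto r atTop (𝓝 l)) (hl : ‖l‖ < 1) : Summable u := by
  obtain ⟨s, hs1, hs2⟩ := exists_between hl
  refine summable_of_ratio_norm_eventually_le hs2
    ((hr.norm.eventually_lt_const hs1).mono fun n hn => ?_)
  rw [hu, norm_mul, mul_comm]
  gcongr

theorem tendsto_psi_ratio {q : ℂ} (hq : ‖q‖ < 1) (t : ℂ) :
    Tendsto (fun n : ℕ => (t - q ^ n) / (1 - t * q ^ (n + 1))) atTop (𝓝 t) := by
  have h1 := tendsto_pow_atTop_nhds_zero_of_norm_lt_one hq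
  have h2 := (tendsto_add_atTop_iff_nat 1).2 h1
  have h3 := (h1.const_sub t).div ((h2.const_mul t).const_sub 1) (by simp)
  simp only [sub_zero, mul_zero, div_one] at h3
  exact h3

theorem summable_psiNat_mul {q t : ℂ} (hq : ‖q‖ < 1) {u r : ℕ → ℂ} {l : ℂ}
    (hu : ∀ n, u (n + 1) = u n * r n) (hr : Tendsto r atTop (𝓝 l)) (hl : ‖t * l‖ < 1) :
    Summable fun n => psiNat q t n * u n :=
  summable_of_ratio_tendsto
    (r := fun n => (t - q ^ n) / (1 - t * q ^ (n + 1)) * r n)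
    (fun n => by rw [psiNat_succ, hu]; ring) ((tendsto_psi_ratio hq t).mul hr) hl

theorem summable_psiCoeff_mul_zpow {q t z : ℂ} (hq : ‖q‖ < 1)
    (h1 : ‖t * z‖ < 1) (h2 : ‖t * (q / z)‖ < 1) : Summable fun n : ℤ => psiCoeff q t n * z ^ n := by
  refine Summable.of_nat_of_neg ?_ ?_
  · simpa using summable_psiNat_mul hq (u := fun n => z ^ n) (r := fun _ => z)
      (fun n => pow_succ _ _) tendsto_const_nhds h1
  · refine (summable_psiNat_mul hq (u := fun n => (q / z) ^ n) (r := fun _ => q / z)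
      (fun n => pow_succ _ _) tendsto_const_nhds h2).congr fun n => ?_
    simp only [psiCoeff_neg_natCast, zpow_neg, zpow_natCast]
    ring

theorem summable_psiCoeff_gauss {q : ℂ} (hq : ‖q‖ < 1) (t w : ℂ) :
    Summable fun n : ℤ => psiCoeff q t n * (q ^ (n ^ 2) * w ^ n) := by
  have key : ∀ w : ℂ, Summable fun n : ℕ => psiNat q t n * (q ^ (n ^ 2) * w ^ n) := fun w => by
    refine summable_psiNat_mul hq (r := fun n => q ^ n * q ^ n * (q * w)) (l := 0)
      (fun n => by ring) ?_ (by simp)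
    have h1 := tendsto_pow_atTop_nhds_zero_of_norm_lt_one hq
    simpa using (h1.mul h1).mul_const (q * w)
  refine Summable.of_nat_of_neg ?_ ?_
  · exact (key w).congr fun n => by
      simp only [psiCoeff_natCast, zpow_natCast]; norm_cast
  · refine (key (q / w)).congr fun n => ?_
    have : q ^ ((-(n : ℤ)) ^ 2) = q ^ (n ^ 2) := by
      rw [neg_sq]; norm_cast
    rw [this]
    simp only [psiCoeff_neg_natCast, zpow_neg, zpow_natCast]
    ring

/-- Dominated convergence along t q^N needs a bound free of N. Once |t q^N| < τ and |t q^N| < 1,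
consecutive terms have ratio at most (τ + |q|^i) |w| / (1 - |q|), and τ is chosen so small that the
limit of this is below 1. No restriction on z remains. -/
theorem exists_bound_psiCoeff {q : ℂ} (hq : ‖q‖ < 1) (t z : ℂ) :
    ∃ b : ℤ → ℝ, Summable b ∧
      ∀ᶠ N : ℕ in atTop, ∀ n : ℤ, ‖psiCoeff q (t * q ^ N) n * z ^ n‖ ≤ b n := by
  have key : ∀ w : ℂ, ∃ b : ℕ → ℝ, Summable b ∧
      ∀ᶠ N : ℕ in atTop, ∀ n : ℕ, ‖psiNat q (t * q ^ N) n * w ^ n‖ ≤ b n := by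
    intro w
    have hq' : 0 < 1 - ‖q‖ := sub_pos.2 hq
    set c : ℝ := ‖w‖ / (1 - ‖q‖) with hc
    have hc0 : 0 ≤ c := by positivity
    obtain ⟨τ, hτ0, hτ⟩ : ∃ τ : ℝ, 0 < τ ∧ τ * c < 1 := by
      refine ⟨1 / (c + 1), by positivity, ?_⟩
      rw [div_mul_eq_mul_div, div_lt_one (by positivity)]
      linarith
    refine ⟨fun n => ∏ i ∈ Finset.range n, (τ + ‖q‖ ^ i) * c, ?_, ?_⟩
    · have hq2 : Tendsto (fun n : ℕ => ‖q‖ ^ n) atTop (𝓝 0) :=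
        tendsto_pow_atTop_nhds_zero_of_lt_one (norm_nonneg _) hq
      have h1 : Tendsto (fun n : ℕ => (τ + ‖q‖ ^ n) * c) atTop (𝓝 (τ * c)) := by
        simpa using (hq2.const_add τ).mul_const c
      obtain ⟨s, hs1, hs2⟩ := exists_between hτ
      refine summable_of_ratio_norm_eventually_le hs2
        ((h1.eventually_lt_const hs1).mono fun n hn => ?_)
      rw [Finset.prod_range_succ, norm_mul, mul_comm]
      gcongr
      rw [Real.norm_of_nonneg (by positivity)]
      exact hn.le
    · have h2 : Tendsto (fun N : ℕ => ‖t * q ^ N‖) atTop (𝓝 0) := by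
        simpa using ((tendsto_pow_atTop_nhds_zero_of_norm_lt_one hq).const_mul t).norm
      filter_upwards [h2.eventually_lt_const hτ0, h2.eventually_lt_const one_pos] with N hN1 hN2 n
      rw [psiNat, show w ^ n = ∏ i ∈ Finset.range n, w by simp, ← Finset.prod_mul_distrib, norm_prod]
      refine Finset.prod_le_prod (fun i _ => norm_nonneg _) fun i _ => ?_
      rw [norm_mul, norm_div, hc, ← mul_div_assoc, div_mul_eq_mul_div]
      have h3 : 1 - ‖q‖ ≤ ‖1 - t * q ^ N * q ^ (i + 1)‖ := by
        have h4 := norm_sub_norm_le (1 : ℂ) (t * q ^ N * q ^ (i + 1))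
        have h5 : ‖t * q ^ N * q ^ (i + 1)‖ ≤ ‖q‖ := by
          rw [norm_mul, norm_pow, pow_succ]
          have := pow_le_one₀ (n := i) (norm_nonneg _) hq.le
          calc _ ≤ 1 * (1 * ‖q‖) := by gcongr
            _ = _ := by ring
        rw [norm_one] at h4
        linarith
      have h6 : ‖t * q ^ N - q ^ i‖ ≤ τ + ‖q‖ ^ i := by
        refine (norm_sub_le _ _).trans ?_
        rw [norm_pow q i]
        linarith
      gcongr
  obtain ⟨b1, hb1, h1⟩ := key z
  -- Negative indices: A_{-n} z^{-n} = A_n (q/z)^n.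
  obtain ⟨b2, hb2, h2⟩ := key (q / z)
  refine ⟨fun n => if 0 ≤ n then b1 n.natAbs else b2 n.natAbs, ?_, ?_⟩
  · refine Summable.of_nat_of_neg (hb1.congr fun n => by simp) ?_
    refine (summable_nat_add_iff 1).1 (((summable_nat_add_iff 1).2 hb2).congr fun n => ?_)
    rw [if_neg (by push_cast; omega)]
    congr 1
  · filter_upwards [h1, h2] with N hN1 hN2 n
    split_ifs with h
    · lift n to ℕ using h
      simpa using hN1 n
    · obtain ⟨m, rfl⟩ : ∃ m : ℕ, n = -(m : ℤ) := ⟨n.natAbs, by omega⟩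
      have := hN2 m
      convert this using 2
      · simp only [psiCoeff_neg_natCast, zpow_neg, zpow_natCast]
        ring
      · simp

theorem tendsto_psiCoeff {q : ℂ} (hq : ‖q‖ < 1) (t : ℂ) (n : ℤ) :
    Tendsto (fun N : ℕ => psiCoeff q (t * q ^ N) n) atTop (𝓝 (psiCoeff q 0 n)) := by
  have key : ∀ m : ℕ, Tendsto (fun N : ℕ => psiNat q (t * q ^ N) m) atTop (𝓝 (psiNat q 0 m)) := by
    intro m
    refine tendsto_finsetProd _ fun i _ => ?_
    have h1 := (tendsto_pow_atTop_nhds_zero_of_norm_lt_one hq).const_mul t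
    rw [mul_zero] at h1
    exact (h1.sub_const _).div ((h1.mul_const _).const_sub 1) (by simp)
  obtain ⟨m, rfl | rfl⟩ := n.eq_nat_or_neg
  · exact key m
  · simpa only [psiCoeff_neg_natCast] using (key m).const_mul (q ^ m)

/-! ### Triple product and ₁ψ₁ sum by iterating t ↦ tq. -/

theorem HasSum.of_eq_of_eq {ι : Type*} {f g : ι → ℂ} {a b : ℂ} (h : HasSum f a)
    (hf : ∀ n, g n = f n) (ha : b = a) : HasSum g b := by
  rw [ha, funext hf]
  exact h

/-- This is `psiCoeff_contiguous` summed against z^n; the extra factor 1 - tq completes (1 - tq)(1 +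
tq) = 1 - t²q². -/
theorem hasSum_psiCoeff_shift {q t z s : ℂ} (hq : q ≠ 0)
    (ht : ∀ j : ℕ, 1 - t * q ^ (j + 1) ≠ 0) (hz : z ≠ 0)
    (h : HasSum (fun n : ℤ => psiCoeff q t n * z ^ n) s) :
    HasSum (fun n : ℤ => ((1 - t ^ 2 * q) * (1 - t ^ 2 * q ^ 2)) *
      (psiCoeff q (t * q) n * z ^ n))
      ((1 - t * q) ^ 2 * ((1 - t * z) * (1 - t * (q / z))) * s) := by
  have h1 : HasSum (fun n : ℤ => psiCoeff q t (n - 1) * z ^ n) (z * s) := by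
    have := ((Equiv.subRight (1 : ℤ)).hasSum_iff.2 h).mul_left z
    refine this.congr_fun fun n => ?_
    simp only [Function.comp, Equiv.subRight_apply, zpow_sub₀ hz, zpow_one]
    field_simp
  have h2 : HasSum (fun n : ℤ => psiCoeff q t (n + 1) * z ^ n) (z⁻¹ * s) := by
    have := ((Equiv.addRight (1 : ℤ)).hasSum_iff.2 h).mul_left z⁻¹
    refine this.congr_fun fun n => ?_
    simp only [Function.comp, Equiv.coe_addRight, zpow_add₀ hz, zpow_one]
    field_simp
  have h3 := (((h.mul_left (1 + t ^ 2 * q)).sub (h1.mul_left t)).sub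
    (h2.mul_left (t * q))).mul_left ((1 - t * q) ^ 2)
  refine h3.of_eq_of_eq (fun n => ?_) ?_
  · linear_combination -(1 - t * q) * z ^ n * psiCoeff_contiguous hq ht n
  · field_simp
    ring

theorem one_sub_ne_zero_of_norm_lt {w : ℂ} (h : ‖w‖ < 1) : 1 - w ≠ 0 := fun h0 => by
  rw [← sub_eq_zero.1 h0] at h
  simp at h

theorem norm_mul_pow_lt_one {q a : ℂ} (hq : ‖q‖ < 1) (ha : ‖a‖ < 1) (j : ℕ) : ‖a * q ^ j‖ < 1 := by
  rw [norm_mul, norm_pow]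
  exact mul_lt_one_of_nonneg_of_lt_one_left (norm_nonneg _) ha (pow_le_one₀ (norm_nonneg _) hq.le)

theorem norm_mul_q_lt_one {q t : ℂ} (hq : ‖q‖ < 1) (ht : ‖t ^ 2 * q‖ < 1) : ‖t * q‖ < 1 := by
  have : ‖t * q‖ ^ 2 < 1 := by
    rw [← norm_pow, show (t * q) ^ 2 = t ^ 2 * q * q ^ 1 by ring]
    exact norm_mul_pow_lt_one hq ht 1
  exact (sq_lt_one_iff₀ (norm_nonneg _)).1 this

theorem one_sub_mul_pow_succ_ne_zero {q t : ℂ} (hq : ‖q‖ < 1) (ht : ‖t ^ 2 * q‖ < 1) (j : ℕ) :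
    1 - t * q ^ (j + 1) ≠ 0 := by
  rw [pow_succ', ← mul_assoc]
  exact one_sub_ne_zero_of_norm_lt (norm_mul_pow_lt_one hq (norm_mul_q_lt_one hq ht) j)

theorem norm_sq_mul_pow_lt_one {q t : ℂ} (hq : ‖q‖ < 1) (ht : ‖t ^ 2 * q‖ < 1) (N : ℕ) :
    ‖(t * q ^ N) ^ 2 * q‖ < 1 := by
  rw [show (t * q ^ N) ^ 2 * q = t ^ 2 * q * q ^ (2 * N) by ring]
  exact norm_mul_pow_lt_one hq ht _

/-- One step replaces t² q by t² q³ and so consumes two factors of (t²q)_∞, whence `range (2 * N)`,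
but one factor of each of the other symbols. -/
theorem hasSum_psiCoeff_shift_iterate {q t z s : ℂ} (hq0 : q ≠ 0) (hq : ‖q‖ < 1)
    (ht : ‖t ^ 2 * q‖ < 1) (hz : z ≠ 0)
    (h : HasSum (fun n : ℤ => psiCoeff q t n * z ^ n) s) (N : ℕ) :
    HasSum (fun n : ℤ => psiCoeff q (t * q ^ N) n * z ^ n)
      (((∏ j ∈ Finset.range N, (1 - t * q * q ^ j)) ^ 2 *
        ((∏ j ∈ Finset.range N, (1 - t * z * q ^ j)) *
          ∏ j ∈ Finset.range N, (1 - t * (q / z) * q ^ j))) /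
        (∏ j ∈ Finset.range (2 * N), (1 - t ^ 2 * q * q ^ j)) * s) := by
  have hne : ∀ j, 1 - t ^ 2 * q * q ^ j ≠ 0 := fun j =>
    one_sub_ne_zero_of_norm_lt (norm_mul_pow_lt_one hq ht j)
  induction N with
  | zero => simpa using h
  | succ N ih =>
    have hN := norm_sq_mul_pow_lt_one hq ht N
    have h1 := hasSum_psiCoeff_shift hq0 (one_sub_mul_pow_succ_ne_zero hq hN) hz ih
    have e1 : 1 - (t * q ^ N) ^ 2 * q = 1 - t ^ 2 * q * q ^ (2 * N) := by ring
    have e2 : 1 - (t * q ^ N) ^ 2 * q ^ 2 = 1 - t ^ 2 * q * q ^ (2 * N + 1) := by ring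
    rw [e1, e2] at h1
    have n1 := hne (2 * N)
    have n2 := hne (2 * N + 1)
    have n3 : ∏ j ∈ Finset.range (2 * N), (1 - t ^ 2 * q * q ^ j) ≠ 0 :=
      Finset.prod_ne_zero_iff.2 fun j _ => hne j
    have h2 := h1.mul_left (((1 - t ^ 2 * q * q ^ (2 * N)) *
      (1 - t ^ 2 * q * q ^ (2 * N + 1)))⁻¹)
    refine h2.of_eq_of_eq (fun n => ?_) ?_
    · rw [inv_mul_cancel_left₀ (mul_ne_zero n1 n2)]
      ring_nf
    · rw [Nat.mul_succ, Finset.prod_range_succ, Finset.prod_range_succ, Finset.prod_range_succ,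
        Finset.prod_range_succ, Finset.prod_range_succ]
      generalize ∏ j ∈ Finset.range (2 * N), (1 - t ^ 2 * q * q ^ j) = E at *
      generalize ∏ j ∈ Finset.range N, (1 - t * q * q ^ j) = E1 at *
      generalize ∏ j ∈ Finset.range N, (1 - t * z * q ^ j) = E2 at *
      generalize ∏ j ∈ Finset.range N, (1 - t * (q / z) * q ^ j) = E3 at *
      generalize 1 - t ^ 2 * q * q ^ (2 * N) = F1 at *
      generalize 1 - t ^ 2 * q * q ^ (2 * N + 1) = F2 at *
      field_simp

/-- The limit N → ∞ of the iteration. The series on the right does not involve t, so the single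
value t = 1 determines it. -/
theorem qPoch_mul_hasSum_psiCoeff {q t z s : ℂ} (hq0 : q ≠ 0) (hq : ‖q‖ < 1)
    (ht : ‖t ^ 2 * q‖ < 1) (hz : z ≠ 0)
    (h : HasSum (fun n : ℤ => psiCoeff q t n * z ^ n) s) :
    qPoch q (t * q) ^ 2 * (qPoch q (t * z) * qPoch q (t * (q / z))) * s =
      qPoch q (t ^ 2 * q) * ∑' n : ℤ, psiCoeff q 0 n * z ^ n := by
  obtain ⟨b, hb, hN⟩ := exists_bound_psiCoeff hq t z
  have h1 : Tendsto (fun N : ℕ => ∑' n : ℤ, psiCoeff q (t * q ^ N) n * z ^ n) atTop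
      (𝓝 (∑' n : ℤ, psiCoeff q 0 n * z ^ n)) :=
    tendsto_tsum_of_dominated_convergence hb
      (fun n => (tendsto_psiCoeff hq t n).mul_const _) hN
  simp_rw [fun N => (hasSum_psiCoeff_shift_iterate hq0 hq ht hz h N).tsum_eq] at h1
  have hne := qPoch_ne_zero_of_norm_lt_one hq ht
  have h2 := (((((hasProd_qPoch hq (t * q)).tendsto_prod_nat.pow 2).mul
    ((hasProd_qPoch hq (t * z)).tendsto_prod_nat.mul
      (hasProd_qPoch hq (t * (q / z))).tendsto_prod_nat)).div
    ((hasProd_qPoch hq (t ^ 2 * q)).tendsto_prod_nat.comp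
      (tendsto_id.const_mul_atTop' (two_pos : 0 < 2))) hne)).mul_const s
  rw [tendsto_nhds_unique h1 h2]
  field_simp

/-- The Jacobi triple product identity. -/
theorem tsum_psiCoeff_zero_mul_zpow {q z : ℂ} (hq0 : q ≠ 0) (hq : ‖q‖ < 1) (hz : z ≠ 0) :
    ∑' n : ℤ, psiCoeff q 0 n * z ^ n = qPoch q q * (qPoch q z * qPoch q (q / z)) := by
  have h : HasSum (fun n : ℤ => psiCoeff q 1 n * z ^ n) 1 := by
    simpa using hasSum_single (0 : ℤ) (f := fun n : ℤ => psiCoeff q 1 n * z ^ n) fun n hn => by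
      simp [psiCoeff_one n hn]
  have h1 := qPoch_mul_hasSum_psiCoeff hq0 hq (by simpa using hq) hz h
  simp only [one_mul, mul_one, one_pow] at h1
  exact mul_left_cancel₀ (qPoch_ne_zero_of_norm_lt_one hq hq) (by rw [← h1]; ring)

/-- Ramanujan's `₁ψ₁` summation in the case that gives the Laurent expansion of `μ`. -/
theorem hasSum_psiCoeff {q t z : ℂ} (hq0 : q ≠ 0) (hq : ‖q‖ < 1) (ht : ‖t ^ 2 * q‖ < 1)
    (hz : z ≠ 0) (h1 : ‖t * z‖ < 1) (h2 : ‖t * (q / z)‖ < 1) :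
    HasSum (fun n : ℤ => qPoch q (t * q) ^ 2 / (qPoch q q * qPoch q (t ^ 2 * q)) *
      (psiCoeff q t n * z ^ n))
      (qPoch q z * qPoch q (q / z) / (qPoch q (t * z) * qPoch q (t * (q / z)))) := by
  have hs := summable_psiCoeff_mul_zpow hq h1 h2
  have h3 := qPoch_mul_hasSum_psiCoeff hq0 hq ht hz hs.hasSum
  rw [tsum_psiCoeff_zero_mul_zpow hq0 hq hz] at h3
  refine (hs.hasSum.mul_left
    (qPoch q (t * q) ^ 2 / (qPoch q q * qPoch q (t ^ 2 * q)))).of_eq_of_eq (fun _ => rfl) ?_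
  have n1 := qPoch_ne_zero_of_norm_lt_one hq h1
  have n2 := qPoch_ne_zero_of_norm_lt_one hq h2
  have n3 := qPoch_ne_zero_of_norm_lt_one hq hq
  have n4 := qPoch_ne_zero_of_norm_lt_one hq ht
  generalize qPoch q (t * z) = a at *
  generalize qPoch q (t * (q / z)) = b at *
  generalize qPoch q (t ^ 2 * q) = c at *
  generalize qPoch q (t * q) = d at *
  field_simp
  linear_combination -h3

/-! ### The Gaussian moment of the ₁ψ₁ coefficients. -/

/-- The moments `∑ A_n q^{n² + m n}` of the `₁ψ₁` coefficients. -/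
noncomputable def psiMoment (q t : ℂ) (m : ℤ) : ℂ :=
  ∑' n : ℤ, psiCoeff q t n * (q ^ (n ^ 2) * (q ^ m) ^ n)

theorem hasSum_psiMoment {q : ℂ} (hq : ‖q‖ < 1) (t : ℂ) (m : ℤ) :
    HasSum (fun n : ℤ => psiCoeff q t n * (q ^ (n ^ 2) * (q ^ m) ^ n)) (psiMoment q t m) :=
  (summable_psiCoeff_gauss hq t _).hasSum

theorem psiMoment_one_sub {q : ℂ} (hq0 : q ≠ 0) (t : ℂ) (m : ℤ) :
    psiMoment q t (1 - m) = psiMoment q t m := by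
  rw [psiMoment, psiMoment, ← (Equiv.neg ℤ).tsum_eq]
  refine tsum_congr fun n => ?_
  simp only [Equiv.neg_apply, psiCoeff_neg hq0, neg_sq, ← zpow_mul]
  rw [show (1 - m) * -n = m * n + -n by ring, zpow_add₀ hq0, zpow_neg]
  field_simp

/-- The first-order recurrence `psiCoeff_add_one` for A_n, multiplied by a Gaussian and summed after
the shift n ↦ n + 1. -/
theorem psiMoment_recurrence {q t : ℂ} (hq0 : q ≠ 0) (hq : ‖q‖ < 1)
    (ht : ∀ j : ℕ, 1 - t * q ^ (j + 1) ≠ 0) (m : ℤ) :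
    psiMoment q t m - t * psiMoment q t (m + 1) =
      q ^ (m + 1) * (t * psiMoment q t (m + 2) - psiMoment q t (m + 3)) := by
  have h1 := (hasSum_psiMoment hq t m).sub ((hasSum_psiMoment hq t (m + 1)).mul_left t)
  have h2 := (((hasSum_psiMoment hq t (m + 2)).mul_left t).sub
    (hasSum_psiMoment hq t (m + 3))).mul_left (q ^ (m + 1))
  refine ((Equiv.addRight (1 : ℤ)).hasSum_iff.2 h1).unique ?_
  refine h2.of_eq_of_eq (fun n => ?_) rfl
  simp only [Function.comp, Equiv.coe_addRight, ← zpow_mul]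
  have e := psiCoeff_add_one hq0 ht n
  have e1 : q ^ ((n + 1) ^ 2) = q ^ (n ^ 2) * (q ^ n) ^ 2 * q := by
    rw [show (n + 1) ^ 2 = n ^ 2 + (n + n) + 1 by ring, zpow_add₀ hq0, zpow_add₀ hq0,
      zpow_add₀ hq0, zpow_one]; ring
  have e2 : q ^ (m * (n + 1)) = q ^ (m * n) * q ^ m := by
    rw [← zpow_add₀ hq0]; ring_nf
  have e3 : q ^ ((m + 1) * (n + 1)) = q ^ (m * n) * q ^ m * (q ^ n * q) := by
    rw [← zpow_add₀ hq0, ← zpow_add_one₀ hq0, ← zpow_add₀ hq0]; ring_nf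
  have e4 : q ^ ((m + 2) * n) = q ^ (m * n) * (q ^ n) ^ 2 := by
    rw [show (m + 2) * n = m * n + (n + n) by ring, zpow_add₀ hq0, zpow_add₀ hq0]; ring
  have e5 : q ^ ((m + 3) * n) = q ^ (m * n) * (q ^ n) ^ 3 := by
    rw [show (m + 3) * n = m * n + (n + n + n) by ring, zpow_add₀ hq0, zpow_add₀ hq0,
      zpow_add₀ hq0]; ring
  rw [e1, e2, e3, e4, e5, zpow_add_one₀ hq0 m]
  rw [zpow_add_one₀ hq0] at e
  linear_combination (q ^ (n ^ 2) * (q ^ n) ^ 2 * q * q ^ (m * n) * q ^ m) * e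

/-- Write M_m for the moments. The symmetry m ↦ 1 - m identifies M_1 = M_0 and M_2 = M_{-1}; the
recurrence at m = -1 and m = -2 then makes M_{-1} and M_{-2} multiples of M_0. The contiguous
relation summed against q^{n²} involves only M_0, M_2 and M_{-2}, so it closes on M_0. -/
theorem psiMoment_zero_mul_q {q t : ℂ} (hq0 : q ≠ 0) (hq : ‖q‖ < 1) (ht : ‖t ^ 2 * q‖ < 1) :
    psiMoment q (t * q) 0 = (1 - t * q) * psiMoment q t 0 := by
  have ht' := one_sub_mul_pow_succ_ne_zero hq ht
  have s0 := psiMoment_one_sub hq0 t 0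
  have s1 := psiMoment_one_sub hq0 t (-1)
  have r1 := psiMoment_recurrence hq0 hq ht' (-1)
  have r2 := psiMoment_recurrence hq0 hq ht' (-2)
  norm_num at s0 s1 r1 r2
  have a1 : HasSum (fun n : ℤ => psiCoeff q t (n - 1) * q ^ (n ^ 2)) (q * psiMoment q t 2) := by
    have := (Equiv.subRight (1 : ℤ)).hasSum_iff.2 ((hasSum_psiMoment hq t 2).mul_left q)
    refine this.congr_fun fun n => ?_
    simp only [Function.comp, Equiv.subRight_apply, ← zpow_mul, ← zpow_add₀ hq0]
    rw [mul_left_comm, ← zpow_one_add₀ hq0]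
    ring_nf
  have a2 : HasSum (fun n : ℤ => psiCoeff q t (n + 1) * q ^ (n ^ 2)) (q * psiMoment q t (-2)) := by
    have := (Equiv.addRight (1 : ℤ)).hasSum_iff.2 ((hasSum_psiMoment hq t (-2)).mul_left q)
    refine this.congr_fun fun n => ?_
    simp only [Function.comp, Equiv.coe_addRight, ← zpow_mul, ← zpow_add₀ hq0]
    rw [mul_left_comm, ← zpow_one_add₀ hq0]
    ring_nf
  have h := ((((hasSum_psiMoment hq t 0).mul_left (1 + t ^ 2 * q)).sub (a1.mul_left t)).sub
    (a2.mul_left (t * q))).mul_left (1 - t * q)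
  have h' := (hasSum_psiMoment hq (t * q) 0).mul_left ((1 + t * q) * (1 - t ^ 2 * q))
  have e := h'.unique (by
    refine h.of_eq_of_eq (fun n => ?_) rfl
    simp only [zpow_zero, one_zpow, mul_one]
    linear_combination -q ^ (n ^ 2) * psiCoeff_contiguous hq0 ht' n)
  have n1 : 1 - t ^ 2 * q ≠ 0 := one_sub_ne_zero_of_norm_lt ht
  have n2 : 1 + t * q ≠ 0 := by
    rw [← sub_neg_eq_add]
    exact one_sub_ne_zero_of_norm_lt (by rw [norm_neg]; exact norm_mul_q_lt_one hq ht)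
  refine mul_left_cancel₀ (mul_ne_zero n2 n1) ?_
  rw [e]
  have m1 : psiMoment q t (-1) = t * psiMoment q t 0 := by
    linear_combination (1 / 2) * r1 + (t / 2) * s0 - (1 / 2) * s1
  have m2 : q * psiMoment q t (-2) = (t ^ 2 * q + t - 1) * psiMoment q t 0 := by
    have : q * q⁻¹ = 1 := mul_inv_cancel₀ hq0
    linear_combination q * r2 + t * q * m1 + (t * psiMoment q t 0 - psiMoment q t 1) * this - s0
  rw [m2, s1, m1]
  ring

theorem psiMoment_zero {q t : ℂ} (hq0 : q ≠ 0) (hq : ‖q‖ < 1) (ht : ‖t ^ 2 * q‖ < 1) :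
    psiMoment q t 0 = qPoch q q / qPoch q (t * q) := by
  have key : ∀ t : ℂ, ‖t ^ 2 * q‖ < 1 →
      qPoch q (t * q) * psiMoment q t 0 = ∑' n : ℤ, psiCoeff q 0 n * q ^ (n ^ 2) := by
    intro t ht
    have h1 : ∀ N : ℕ, psiMoment q (t * q ^ N) 0 =
        (∏ j ∈ Finset.range N, (1 - t * q * q ^ j)) * psiMoment q t 0 := by
      intro N
      induction N with
      | zero => simp
      | succ N ih =>
        rw [pow_succ, ← mul_assoc, psiMoment_zero_mul_q hq0 hq (norm_sq_mul_pow_lt_one hq ht N),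
          ih, Finset.prod_range_succ]
        ring
    obtain ⟨b, hb, hN⟩ := exists_bound_psiCoeff hq t 1
    -- The bound for z = 1 suffices, because |q^{n²}| ≤ 1.
    have h2 : Tendsto (fun N : ℕ => psiMoment q (t * q ^ N) 0) atTop
        (𝓝 (∑' n : ℤ, psiCoeff q 0 n * q ^ (n ^ 2))) := by
      simp only [psiMoment, zpow_zero, one_zpow, mul_one]
      refine tendsto_tsum_of_dominated_convergence hb
        (fun n => (tendsto_psiCoeff hq t n).mul_const _) (hN.mono fun N h n => ?_)
      refine le_trans ?_ (h n)
      rw [norm_mul, norm_mul, one_zpow, norm_one]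
      gcongr
      obtain ⟨m, hm⟩ := Int.eq_ofNat_of_zero_le (sq_nonneg n)
      rw [hm, zpow_natCast, norm_pow]
      exact pow_le_one₀ (norm_nonneg _) hq.le
    simp_rw [h1] at h2
    exact tendsto_nhds_unique ((hasProd_qPoch hq (t * q)).tendsto_prod_nat.mul_const _) h2
  have h0 : psiMoment q 1 0 = 1 := by
    rw [psiMoment, tsum_eq_single 0 fun n hn => by simp [psiCoeff_one n hn]]
    simp
  have h1 := key 1 (by simpa using hq)
  rw [h0, one_mul, mul_one, ← key t ht] at h1
  rw [h1, mul_div_cancel_left₀ _ (qPoch_ne_zero_of_norm_lt_one hq (norm_mul_q_lt_one hq ht))]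

/-! ### The constant term of the Laurent expansion. -/

theorem summable_zpow_sq_mul_zpow {r : ℂ} (hr : ‖r‖ < 1) (w : ℂ) :
    Summable fun n : ℤ => r ^ (n ^ 2) * w ^ n := by
  have key : ∀ w : ℂ, Summable fun n : ℕ => r ^ (n ^ 2) * w ^ n := fun w => by
    refine summable_of_ratio_tendsto (r := fun n => r ^ n * r ^ n * (r * w)) (l := 0)
      (fun n => by ring) ?_ (by simp)
    have h1 := tendsto_pow_atTop_nhds_zero_of_norm_lt_one hr
    simpa using (h1.mul h1).mul_const (r * w)
  refine Summable.of_nat_of_neg ?_ ?_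
  · exact (key w).congr fun n => by rw [zpow_natCast]; norm_cast
  · refine (key w⁻¹).congr fun n => ?_
    rw [neg_sq, zpow_neg, ← inv_zpow, zpow_natCast]
    norm_cast

theorem norm_cpow_inv_natCast_lt_one {q : ℂ} (hq : ‖q‖ < 1) (n : ℕ) (hn : n ≠ 0) :
    ‖q ^ ((n : ℂ)⁻¹)‖ < 1 := by
  have h : ‖q ^ ((n : ℂ)⁻¹)‖ ^ n < 1 := by
    rwa [← norm_pow, Complex.cpow_nat_inv_pow q hn]
  exact (pow_lt_one_iff_of_nonneg (norm_nonneg _) hn).1 h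

theorem cpow_int_sq_div_four (q : ℂ) (n : ℤ) :
    q ^ ((n : ℂ) ^ 2 / 4) = (q ^ (((4 : ℕ) : ℂ)⁻¹)) ^ (n ^ 2) := by
  rw [← Complex.cpow_int_mul]
  push_cast
  rw [div_eq_mul_inv]

theorem summable_invGauss {q : ℂ} (hq : ‖q‖ < 1) (x : ℂ) :
    Summable fun n : ℤ => q ^ ((n : ℂ) ^ 2 / 4) * q ^ ((n : ℂ) * x) := by
  refine (summable_zpow_sq_mul_zpow (norm_cpow_inv_natCast_lt_one hq 4 (by norm_num))
    (q ^ x)).congr fun n => ?_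
  rw [cpow_int_sq_div_four, Complex.cpow_int_mul]

theorem integral_exp_int_mul_I (n : ℤ) :
    ∫ θ in (0 : ℝ)..(2 * Real.pi), Complex.exp (n * θ * Complex.I) =
      if n = 0 then 2 * Real.pi else 0 := by
  split_ifs with h
  · simp [h]
  · have h1 : (n : ℂ) * Complex.I ≠ 0 := mul_ne_zero (by exact_mod_cast h) Complex.I_ne_zero
    have h2 := integral_exp_mul_complex (a := 0) (b := 2 * Real.pi) h1
    have h3 : Complex.exp (n * Complex.I * (2 * Real.pi : ℝ)) = 1 := by
      rw [show (n : ℂ) * Complex.I * (2 * Real.pi : ℝ) = n * (2 * Real.pi * Complex.I) by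
        push_cast; ring]
      exact Complex.exp_int_mul_two_pi_mul_I n
    rw [h3] at h2
    simp only [Complex.ofReal_zero, mul_zero, Complex.exp_zero, sub_self, zero_div] at h2
    rw [Complex.ofReal_zero, ← h2]
    congr 1; ext θ; ring_nf

/-- The zeroth Fourier coefficient of an absolutely convergent trigonometric series. -/
theorem integral_of_hasSum_exp {a : ℤ → ℂ} {g : ℝ → ℂ}
    (h : ∀ θ : ℝ, HasSum (fun n : ℤ => a n * Complex.exp (n * θ * Complex.I)) (g θ)) :
    ∫ θ in (0 : ℝ)..(2 * Real.pi), g θ = 2 * Real.pi * a 0 := by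
  have hpi : (0 : ℝ) ≤ 2 * Real.pi := by positivity
  have ha : Summable fun n => ‖a n‖ := by
    have := (h 0).summable.norm
    simpa using this
  have hn : ∀ (n : ℤ) (θ : ℝ), ‖a n * Complex.exp (n * θ * Complex.I)‖ = ‖a n‖ := fun n θ => by
    rw [norm_mul, show (n : ℂ) * θ * Complex.I = ((n * θ : ℝ) : ℂ) * Complex.I by push_cast; ring,
      Complex.norm_exp_ofReal_mul_I, mul_one]
  have h1 := MeasureTheory.hasSum_integral_of_summable_integral_norm
    (μ := MeasureTheory.volume.restrict (Set.Ioc 0 (2 * Real.pi)))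
    (F := fun (n : ℤ) (θ : ℝ) => a n * Complex.exp (n * θ * Complex.I))
    (fun n => by
      have : Continuous fun θ : ℝ => a n * Complex.exp (n * θ * Complex.I) := by fun_prop
      exact (this.intervalIntegrable 0 (2 * Real.pi)).1)
    (by
      simp_rw [hn, MeasureTheory.integral_const]
      exact ha.const_smul _)
  simp_rw [fun θ => (h θ).tsum_eq, ← intervalIntegral.integral_of_le hpi,
    intervalIntegral.integral_const_mul, integral_exp_int_mul_I] at h1
  have h2 := hasSum_single (0 : ℤ) (f := fun n : ℤ =>
    a n * ((if n = 0 then 2 * Real.pi else 0 : ℝ) : ℂ))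
    fun n hn => by simp [hn]
  rw [h1.unique h2]
  simp [mul_comm]

/-- On the line x₀ + θ i / log q the monomial q^{nx} equals q^{n x₀} e^{inθ}. The mean of f over one
period is therefore c 0 for every expansion c, which proves uniqueness. -/
theorem HasConstTerm.intro {q : ℂ} (hq0 : q ≠ 0) (hq : ‖q‖ < 1) {D : Set ℂ} {f : ℂ → ℂ}
    {c : ℤ → ℂ} (hc : IsLaurentExpansion q D f c) {x₀ : ℂ}
    (hD : ∀ θ : ℝ, x₀ + θ * (Complex.I / Complex.log q) ∈ D) : HasConstTerm q D f (c 0) := by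
  have hlog : Complex.log q ≠ 0 := by
    intro h
    have := Complex.exp_log hq0
    rw [h, Complex.exp_zero] at this
    rw [← this] at hq
    simp at hq
  have key : ∀ c, IsLaurentExpansion q D f c →
      ∫ θ in (0 : ℝ)..(2 * Real.pi), f (x₀ + θ * (Complex.I / Complex.log q)) =
        2 * Real.pi * c 0 := by
    intro c hc
    have := integral_of_hasSum_exp (a := fun n => c n * q ^ ((n : ℂ) * x₀))
      (g := fun θ => f (x₀ + θ * (Complex.I / Complex.log q))) fun θ => by
        refine (hc _ (hD θ)).of_eq_of_eq (fun n => ?_) rfl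
        rw [mul_add, Complex.cpow_add _ _ hq0, mul_assoc]
        congr 2
        rw [Complex.cpow_def_of_ne_zero hq0]
        congr 1
        field_simp
    simpa using this
  refine ⟨⟨c, hc⟩, fun c' hc' => ?_⟩
  have h := (key c' hc').symm.trans (key c hc)
  have h2 : (2 * Real.pi : ℂ) ≠ 0 := by
    exact_mod_cast (by positivity : (2 * Real.pi : ℝ) ≠ 0)
  exact mul_left_cancel₀ h2 h

theorem norm_cpow_add_mul_I_div_log {q : ℂ} (hq0 : q ≠ 0) (hq : Complex.log q ≠ 0) (s : ℂ)
    (θ : ℝ) : ‖q ^ (s + θ * (Complex.I / Complex.log q))‖ = ‖q ^ s‖ := by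
  rw [Complex.cpow_add _ _ hq0, norm_mul, Complex.cpow_def_of_ne_zero hq0 (_ * _),
    show Complex.log q * (θ * (Complex.I / Complex.log q)) = θ * Complex.I by field_simp,
    Complex.norm_exp_ofReal_mul_I, mul_one]

theorem hasConstTerm_invGaussSeries_mul_qMu {q k : ℂ} (hq0 : q ≠ 0) (hq : ‖q‖ < 1)
    (hk : ‖q ^ (1 + 2 * k)‖ < 1) :
    HasConstTerm q (muDomain q k) (fun x => invGaussSeries q x * qMu q k x)
        (∏' j : ℕ, (1 - q ^ ((j : ℂ) + 1 + k)) / (1 - q ^ ((j : ℂ) + 1 + 2 * k))) := by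
  set t := q ^ k with ht_def
  have ht : ‖t ^ 2 * q‖ < 1 := by
    rwa [Complex.cpow_add _ _ hq0, Complex.cpow_one, show (2 : ℂ) = (2 : ℕ) by norm_num,
      Complex.cpow_nat_mul, mul_comm] at hk
  have e1 : ∀ s : ℂ, q ^ (k + s) = t * q ^ s := fun s => Complex.cpow_add _ _ hq0
  set B : ℤ → ℂ := fun n => qPoch q (t * q) ^ 2 / (qPoch q q * qPoch q (t ^ 2 * q)) *
    psiCoeff q t n with hB
  have hmu : ∀ x ∈ muDomain q k, HasSum (fun m : ℤ => B m * (q ^ (2 * x)) ^ m) (qMu q k x) := by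
    rintro x ⟨hx1, hx2⟩
    have hz : q ^ (2 * x) ≠ 0 := by simp [Complex.cpow_eq_zero_iff, hq0]
    have e3 : q ^ (1 - 2 * x) = q / q ^ (2 * x) := by rw [Complex.cpow_sub _ _ hq0, Complex.cpow_one]
    rw [qMu_eq hq0 hq]
    rw [add_sub_assoc, e1, e3] at hx2
    rw [e1] at hx1
    rw [add_sub_assoc, e1, e1, e3]
    refine (hasSum_psiCoeff hq0 hq ht hz hx1 hx2).of_eq_of_eq (fun n => ?_) rfl
    rw [hB]
    ring
  set c : ℤ → ℂ := fun N => ∑' m : ℤ, q ^ (((N - 2 * m : ℤ) : ℂ) ^ 2 / 4) * B m with hc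
  have hexp : IsLaurentExpansion q (muDomain q k) (fun x => invGaussSeries q x * qMu q k x) c := by
    intro x hx
    have hs1 := summable_invGauss hq x
    have hs2 := (hmu x hx)
    have hs := summable_mul_of_summable_norm hs1.norm hs2.summable.norm
    have hp := hs1.hasSum.mul hs2 hs
    -- Since z = q^{2x}, the product q^{nx} z^m contributes to the index N = n + 2m; `φ` groups the
    -- double series by N.
    let φ : ℤ × ℤ ≃ ℤ × ℤ :=
      { toFun := fun p => (p.1 - 2 * p.2, p.2)
        invFun := fun p => (p.1 + 2 * p.2, p.2)
        left_inv := fun p => by simp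
        right_inv := fun p => by simp }
    have hp2 := φ.hasSum_iff.2 hp
    have hp3 := hp2.prod_fiberwise fun N => (hp2.summable.prod_factor N).hasSum
    refine hp3.of_eq_of_eq (fun N => ?_) rfl
    rw [hc, ← tsum_mul_right]
    refine tsum_congr fun m => ?_
    have : q ^ ((N : ℂ) * x) = q ^ (((N - 2 * m : ℤ) : ℂ) * x) * (q ^ (2 * x)) ^ m := by
      rw [← Complex.cpow_int_mul, ← Complex.cpow_add _ _ hq0]
      push_cast
      ring_nf
    rw [this]
    simp only [Function.comp, φ, Equiv.coe_fn_mk]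
    ring
  have hlog : Complex.log q ≠ 0 := by
    intro h
    have := Complex.exp_log hq0
    rw [h, Complex.exp_zero] at this
    rw [← this] at hq
    simp at hq
  have hhalf : ‖q ^ (k + 1 / 2)‖ < 1 := by
    have h : ‖q ^ (k + 1 / 2)‖ ^ 2 < 1 := by
      rwa [← norm_pow, ← Complex.cpow_nat_mul,
        show ((2 : ℕ) : ℂ) * (k + 1 / 2) = 1 + 2 * k by push_cast; ring]
    exact (sq_lt_one_iff₀ (norm_nonneg _)).1 h
  -- x₀ = 1/4 is the middle of the annulus: k + 2x₀ and k + 1 - 2x₀ both equal k + 1/2, and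
  -- |q^{k+1/2}|² = |q^{1+2k}| < 1.
  have h := HasConstTerm.intro hq0 hq hexp (x₀ := 1 / 4) fun θ => by
    constructor
    · rw [show k + 2 * (1 / 4 + θ * (Complex.I / Complex.log q)) =
        k + 1 / 2 + ((2 * θ : ℝ) : ℂ) * (Complex.I / Complex.log q) by push_cast; ring,
        norm_cpow_add_mul_I_div_log hq0 hlog]
      exact hhalf
    · rw [show k + 1 - 2 * (1 / 4 + θ * (Complex.I / Complex.log q)) =
        k + 1 / 2 + ((-(2 * θ) : ℝ) : ℂ) * (Complex.I / Complex.log q) by push_cast; ring,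
        norm_cpow_add_mul_I_div_log hq0 hlog]
      exact hhalf
  convert h using 1
  have n1 := qPoch_ne_zero_of_norm_lt_one hq ht
  have n2 := qPoch_ne_zero_of_norm_lt_one hq hq
  have n3 := qPoch_ne_zero_of_norm_lt_one hq (norm_mul_q_lt_one hq ht)
  have hc0 : c 0 = qPoch q (t * q) / qPoch q (t ^ 2 * q) := by
    have : c 0 = qPoch q (t * q) ^ 2 / (qPoch q q * qPoch q (t ^ 2 * q)) * psiMoment q t 0 := by
      rw [hc, psiMoment, ← tsum_mul_left]
      refine tsum_congr fun m => ?_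
      have : q ^ (((0 - 2 * m : ℤ) : ℂ) ^ 2 / 4) = q ^ (m ^ 2) := by
        rw [← Complex.cpow_intCast, show (((0 - 2 * m : ℤ) : ℂ) ^ 2 / 4) = ((m ^ 2 : ℤ) : ℂ) by
          push_cast; ring]
      rw [this, hB]
      simp only [zpow_zero, one_zpow, mul_one]
      ring
    rw [this, psiMoment_zero hq0 hq ht]
    field_simp
  rw [hc0, ← tprod_two_div hq n1]
  refine tprod_congr fun j => ?_
  rw [add_assoc, add_assoc, cpow_natCast_add hq0, cpow_natCast_add hq0, Complex.cpow_add _ _ hq0,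
    Complex.cpow_add _ _ hq0, Complex.cpow_one, show (2 : ℂ) = (2 : ℕ) by norm_num,
    Complex.cpow_nat_mul, mul_comm q t, mul_comm q]

/-! ### The integral along the imaginary axis. -/

theorem ofReal_exp_cpow (a : ℝ) (s : ℂ) :
    ((Real.exp (-1 / a) : ℝ) : ℂ) ^ s = Complex.exp (-(s / a)) := by
  rw [Complex.cpow_def_of_ne_zero (by exact_mod_cast (Real.exp_pos _).ne'),
    ← Complex.ofReal_log (Real.exp_pos _).le, Real.log_exp]
  congr 1
  push_cast
  ring

/-- δ = (μ(z) + μ(1/z)) / (1 + t). After the common infinite products are removed, this is (1 - z)(1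
- t/z) + (1 - 1/z)(1 - tz) = (1 + t)(1 - z)(1 - 1/z). On |z| = 1 both ₁ψ₁ expansions converge. -/
theorem hasSum_delta_coeff {q t z : ℂ} (hq0 : q ≠ 0) (hq : ‖q‖ < 1) (ht : ‖t‖ < 1)
    (hz : ‖z‖ = 1) :
    HasSum (fun n : ℤ => (1 + t)⁻¹ * (qPoch q (t * q) ^ 2 / (qPoch q q * qPoch q (t ^ 2 * q))) *
      (psiCoeff q t n + psiCoeff q t (-n)) * z ^ n)
      (qPoch q z * qPoch q z⁻¹ / (qPoch q (t * z) * qPoch q (t * z⁻¹))) := by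
  have hz0 : z ≠ 0 := norm_ne_zero_iff.1 (by rw [hz]; exact one_ne_zero)
  have htq : ‖t * q‖ < 1 := by simpa using norm_mul_pow_lt_one hq ht 1
  have ht2 : ‖t ^ 2 * q‖ < 1 := by
    rw [pow_two, mul_assoc, norm_mul]
    exact mul_lt_one_of_nonneg_of_lt_one_left (norm_nonneg _) ht htq.le
  have key : ∀ w : ℂ, ‖w‖ = 1 → ‖t * w‖ < 1 ∧ ‖t * (q / w)‖ < 1 := fun w hw => by
    constructor
    · rwa [norm_mul, hw, mul_one]
    · rwa [← mul_div_assoc, norm_div, hw, div_one]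
  have hz' : ‖z⁻¹‖ = 1 := by rw [norm_inv, hz, inv_one]
  have h1 := hasSum_psiCoeff hq0 hq ht2 hz0 (key z hz).1 (key z hz).2
  have h2 := (Equiv.neg ℤ).hasSum_iff.2
    (hasSum_psiCoeff hq0 hq ht2 (inv_ne_zero hz0) (key _ hz').1 (key _ hz').2)
  have n0 : 1 + t ≠ 0 := by
    rw [← sub_neg_eq_add]
    exact one_sub_ne_zero_of_norm_lt (by rwa [norm_neg])
  refine ((h1.add h2).mul_left (1 + t)⁻¹).of_eq_of_eq (fun n => ?_) ?_
  · simp only [Function.comp, Equiv.neg_apply, inv_zpow, zpow_neg, inv_inv]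
    ring
  · have a1 := key z hz
    have a2 := key _ hz'
    rw [qPoch_succ hq z, qPoch_succ hq z⁻¹, qPoch_succ hq (t * z), qPoch_succ hq (t * z⁻¹)]
    have n1 := one_sub_ne_zero_of_norm_lt a1.1
    have n2 := one_sub_ne_zero_of_norm_lt a2.1
    have n3 := qPoch_ne_zero_of_norm_lt_one hq a1.2
    have n4 := qPoch_ne_zero_of_norm_lt_one hq a2.2
    rw [show t * (q / z⁻¹) = t * z * q by field_simp] at n4 ⊢
    rw [show t * (q / z) = t * z⁻¹ * q by field_simp] at n3 ⊢
    rw [show q / z⁻¹ = z * q by field_simp, show q / z = z⁻¹ * q by field_simp]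
    generalize qPoch q (t * z⁻¹ * q) = A at *
    generalize qPoch q (t * z * q) = B at *
    generalize qPoch q (z⁻¹ * q) = C at *
    generalize qPoch q (z * q) = D at *
    rw [mul_comm t z] at n1 ⊢
    have n5 : z - t ≠ 0 := by
      intro h
      rw [← sub_eq_zero.1 h, mul_inv_cancel₀ hz0, sub_self] at n2
      exact n2 rfl
    field_simp
    ring

/-- Termwise integration of an absolutely convergent trigonometric series against a Gaussian. -/
theorem integral_gauss_of_hasSum {a : ℝ} (ha : 0 < a) {d : ℤ → ℂ} {g : ℝ → ℂ}
    (h : ∀ y : ℝ, HasSum (fun n : ℤ => d n * Complex.exp (Complex.I * (-(2 * n / a)) * y)) (g y)) :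
    MeasureTheory.Integrable (fun y : ℝ => g y * Complex.exp (-(1 / a) * y ^ 2)) ∧
    HasSum (fun n : ℤ => d n * (Real.sqrt (a * Real.pi) * Complex.exp (-(n ^ 2 / a))))
      (∫ y : ℝ, g y * Complex.exp (-(1 / a) * y ^ 2)) := by
  have hb : 0 < (1 / a : ℂ).re := by
    rw [← Complex.ofReal_one, ← Complex.ofReal_div, Complex.ofReal_re]
    positivity
  have hd : Summable fun n => ‖d n‖ := by
    have := (h 0).summable.norm
    simpa using this
  have hn1 : ∀ (n : ℤ) (y : ℝ), ‖Complex.exp (Complex.I * (-(2 * n / a)) * y)‖ = 1 :=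
    fun n y => by
      rw [show Complex.I * (-(2 * n / a)) * (y : ℂ) = ((-(2 * n / a) * y : ℝ) : ℂ) * Complex.I by
        push_cast; ring, Complex.norm_exp_ofReal_mul_I]
  have hG : MeasureTheory.Integrable fun y : ℝ => Complex.exp (-(1 / a : ℂ) * y ^ 2) :=
    integrable_cexp_neg_mul_sq hb
  have hcont : Continuous g := by
    have : g = fun y : ℝ => ∑' n : ℤ, d n * Complex.exp (Complex.I * (-(2 * n / a)) * y) :=
      funext fun y => (h y).tsum_eq.symm
    rw [this]
    refine continuous_tsum (fun n => by fun_prop) hd fun n y => ?_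
    rw [norm_mul, hn1, mul_one]
  refine ⟨hG.bdd_mul (c := ∑' n, ‖d n‖) hcont.aestronglyMeasurable (.of_forall fun y => ?_), ?_⟩
  · rw [← (h y).tsum_eq]
    refine (norm_tsum_le_tsum_norm ?_).trans_eq ?_ <;> simp only [norm_mul, hn1, mul_one]
    exact hd
  have h1 := MeasureTheory.hasSum_integral_of_summable_integral_norm
    (μ := MeasureTheory.volume)
    (F := fun (n : ℤ) (y : ℝ) => d n * (Complex.exp (Complex.I * (-(2 * n / a)) * y) *
      Complex.exp (-(1 / a) * y ^ 2)))
    (fun n => by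
      refine MeasureTheory.Integrable.const_mul
        (hG.bdd_mul (c := 1) (by fun_prop) (.of_forall fun y => (hn1 n y).le)) _)
    (by
      simp_rw [norm_mul, hn1, one_mul, MeasureTheory.integral_const_mul]
      exact hd.mul_right _)
  simp_rw [← mul_assoc, fun y : ℝ => ((h y).mul_right (Complex.exp (-(1 / a) * y ^ 2))).tsum_eq,
    mul_assoc] at h1
  refine h1.of_eq_of_eq (fun n => ?_) rfl
  rw [MeasureTheory.integral_const_mul]
  congr 1
  -- Width b = 1/a and frequency -2n/a give √(π/b) = √(aπ) and the exponent -(2n/a)²/(4b) = -n²/a.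
  have h2 := fourierIntegral_gaussian hb (-(2 * n / a))
  simp_rw [mul_assoc] at h2
  rw [h2]
  have ha' : (a : ℂ) ≠ 0 := by exact_mod_cast ha.ne'
  congr 1
  · rw [Real.sqrt_eq_rpow, Complex.ofReal_cpow (by positivity)]
    push_cast
    congr 1
    field_simp
  · congr 1
    field_simp
    ring

theorem imaginaryIntegral_gauss_mul_qDelta {q a : ℝ} {k : ℂ} (hq0 : 0 < q) (hq1 : q < 1)
    (ha : 0 < a) (hqa : q = Real.exp (-1 / a)) (hk : 0 < k.re) :
    MeasureTheory.Integrable (fun y : ℝ =>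
        (q : ℂ) ^ (-(y * Complex.I) ^ 2) * qDelta q k (y * Complex.I)) ∧
      (-Complex.I) * imaginaryIntegral (fun x => (q : ℂ) ^ (-x ^ 2) * qDelta q k x) =
        2 * (Real.sqrt (a * Real.pi) : ℂ) *
          ∏' j : ℕ, (1 - (q : ℂ) ^ ((j : ℂ) + k)) / (1 - (q : ℂ) ^ ((j : ℂ) + 2 * k)) := by
  have hqc : (q : ℂ) ≠ 0 := by exact_mod_cast hq0.ne'
  have hqn : ‖(q : ℂ)‖ < 1 := by rwa [Complex.norm_real, Real.norm_of_nonneg hq0.le]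
  have hpow : ∀ s : ℂ, (q : ℂ) ^ s = Complex.exp (-(s / a)) := fun s => by
    rw [hqa]; exact ofReal_exp_cpow a s
  have ha' : (a : ℂ) ≠ 0 := by exact_mod_cast ha.ne'
  set t : ℂ := (q : ℂ) ^ k with ht_def
  have ht : ‖t‖ < 1 := by
    rw [ht_def, Complex.norm_cpow_eq_rpow_re_of_pos hq0]
    exact Real.rpow_lt_one hq0.le hq1 hk
  have htq : ‖t * q‖ < 1 := by simpa using norm_mul_pow_lt_one hqn ht 1
  have ht2 : ‖t ^ 2‖ < 1 := by rw [norm_pow]; exact pow_lt_one₀ (norm_nonneg _) ht two_ne_zero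
  have ht2q : ‖t ^ 2 * q‖ < 1 := by simpa using norm_mul_pow_lt_one hqn ht2 1
  have hz : ∀ y : ℝ, ‖(q : ℂ) ^ (2 * (y * Complex.I))‖ = 1 := fun y => by
    rw [Complex.norm_cpow_eq_rpow_re_of_pos hq0]
    simp
  set d : ℤ → ℂ := fun n => (1 + t)⁻¹ *
    (qPoch q (t * q) ^ 2 / (qPoch q q * qPoch q (t ^ 2 * q))) *
      (psiCoeff q t n + psiCoeff q t (-n)) with hd
  have hdelta : ∀ y : ℝ, HasSum
      (fun n : ℤ => d n * Complex.exp (Complex.I * (-(2 * n / a)) * y))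
      (qDelta q k (y * Complex.I)) := by
    intro y
    have hz' := hz y
    have e1 : (q : ℂ) ^ (k + 2 * (y * Complex.I)) = t * (q : ℂ) ^ (2 * (y * Complex.I)) :=
      Complex.cpow_add _ _ hqc
    have e2 : (q : ℂ) ^ (-2 * (y * Complex.I)) = ((q : ℂ) ^ (2 * (y * Complex.I)))⁻¹ := by
      rw [← Complex.cpow_neg, neg_mul]
    have e3 : (q : ℂ) ^ (k - 2 * (y * Complex.I)) = t * ((q : ℂ) ^ (2 * (y * Complex.I)))⁻¹ := by
      rw [Complex.cpow_sub _ _ hqc, div_eq_mul_inv]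
    rw [qDelta_eq hqc hqn, e1, e2, e3]
    refine (hasSum_delta_coeff hqc hqn ht hz').of_eq_of_eq (fun n => ?_) rfl
    rw [hd, ← Complex.cpow_int_mul, hpow]
    congr 2
    ring
  obtain ⟨hi, hs⟩ := integral_gauss_of_hasSum ha hdelta
  have e : (fun y : ℝ => (q : ℂ) ^ (-(y * Complex.I) ^ 2) * qDelta q k (y * Complex.I)) =
      fun y : ℝ => qDelta q k (y * Complex.I) * Complex.exp (-(1 / a) * y ^ 2) := by
    ext y
    rw [hpow, mul_comm, mul_pow, Complex.I_sq]
    congr 2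
    ring
  refine ⟨by rw [e]; exact hi, ?_⟩
  have e' : (-Complex.I) * imaginaryIntegral (fun x => (q : ℂ) ^ (-x ^ 2) * qDelta q k x) =
      ∫ y : ℝ, qDelta q k (y * Complex.I) * Complex.exp (-(1 / a) * y ^ 2) := by
    rw [imaginaryIntegral, MeasureTheory.integral_mul_const, mul_comm, mul_assoc, mul_neg,
      Complex.I_mul_I, neg_neg, mul_one]
    exact congrArg (fun f => ∫ y : ℝ, f y) e
  rw [e']
  have n0 : 1 + t ≠ 0 := by
    rw [← sub_neg_eq_add]
    exact one_sub_ne_zero_of_norm_lt (by rwa [norm_neg])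
  have hA := hasSum_psiMoment hqn t 0
  have hA' := (Equiv.neg ℤ).hasSum_iff.2 hA
  have hs' := ((hA.add hA').mul_left ((Real.sqrt (a * Real.pi) : ℂ) * ((1 + t)⁻¹ *
    (qPoch q (t * q) ^ 2 / (qPoch q q * qPoch q (t ^ 2 * q))))))
  have hval := hs.unique (hs'.of_eq_of_eq (fun n => by
    simp only [Function.comp, Equiv.neg_apply, zpow_zero, one_zpow, mul_one, neg_sq, hd]
    rw [← Complex.cpow_intCast, hpow]
    push_cast
    ring) rfl)
  rw [hval, psiMoment_zero hqc hqn ht2q]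
  have n2 := qPoch_ne_zero_of_norm_lt_one hqn ht2
  rw [show ∏' j : ℕ, (1 - (q : ℂ) ^ ((j : ℂ) + k)) / (1 - (q : ℂ) ^ ((j : ℂ) + 2 * k)) =
    qPoch q t / qPoch q (t ^ 2) by
      rw [← tprod_two_div hqn n2]
      refine tprod_congr fun j => ?_
      rw [cpow_natCast_add hqc, cpow_natCast_add hqc, show (2 : ℂ) = (2 : ℕ) by norm_num,
        Complex.cpow_nat_mul]]
  -- The target has (t)_∞ / (t²)_∞ and the moment gives (tq)_∞ / (t²q)_∞; the first factors account
  -- for the 1 + t, as 1 - t² = (1 - t)(1 + t).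
  rw [qPoch_succ hqn t, qPoch_succ hqn (t ^ 2)]
  have n3 := qPoch_ne_zero_of_norm_lt_one hqn hqn
  have n4 := qPoch_ne_zero_of_norm_lt_one hqn htq
  have n5 := qPoch_ne_zero_of_norm_lt_one hqn ht2q
  have n6 := one_sub_ne_zero_of_norm_lt ht2
  generalize qPoch (q : ℂ) q = A at *
  generalize qPoch (q : ℂ) (t * q) = B at *
  generalize qPoch (q : ℂ) (t ^ 2 * q) = C at *
  field_simp
  ring

/-! ### The Jackson sum: recurrence in k and its limit. -/

/-- The bound is free of n, so the products tend to 1 as x → 0 even while the number of factors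
grows; `tendsto_gaussWeightInt` needs this. -/
theorem norm_prod_one_sub_mul_pow_sub_one_le {q : ℂ} (hq : ‖q‖ < 1) (x : ℂ) (n : ℕ) :
    ‖∏ i ∈ Finset.range n, (1 - x * q ^ i) - 1‖ ≤ Real.exp (‖x‖ * (1 - ‖q‖)⁻¹) - 1 := by
  have h := Finset.norm_prod_one_add_sub_one_le (Finset.range n) (fun i => -(x * q ^ i))
  simp only [← sub_eq_add_neg, norm_neg, norm_mul, norm_pow, ← Finset.mul_sum] at h
  refine h.trans ?_
  have : ∑ i ∈ Finset.range n, ‖q‖ ^ i ≤ (1 - ‖q‖)⁻¹ := by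
    rw [← tsum_geometric_of_lt_one (norm_nonneg _) hq]
    exact (summable_geometric_of_lt_one (norm_nonneg _) hq).sum_le_tsum _ fun _ _ => by positivity
  gcongr

theorem norm_prod_one_sub_mul_pow_le {q : ℂ} (hq : ‖q‖ < 1) {x : ℂ} {X : ℝ} (hx : ‖x‖ ≤ X)
    (n : ℕ) : ‖∏ i ∈ Finset.range n, (1 - x * q ^ i)‖ ≤ Real.exp (X * (1 - ‖q‖)⁻¹) := by
  have h1 := norm_prod_one_sub_mul_pow_sub_one_le hq x n
  have h2 := norm_sub_norm_le (∏ i ∈ Finset.range n, (1 - x * q ^ i)) 1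
  rw [norm_one] at h2
  have h3 : Real.exp (‖x‖ * (1 - ‖q‖)⁻¹) ≤ Real.exp (X * (1 - ‖q‖)⁻¹) := by
    have : 0 < 1 - ‖q‖ := sub_pos.2 hq
    gcongr
  linarith

/-- The weight `(1 - t q^j) / (1 - t) * (t²)_j / (q)_j` as a function of `t = q^k`. -/
noncomputable def gaussWeight (q t : ℂ) : ℕ → ℂ
  | 0 => 1
  | (j + 1) => (1 - t * q ^ (j + 1)) * (1 + t) *
      (∏ i ∈ Finset.range j, (1 - t ^ 2 * q * q ^ i)) /
        ∏ i ∈ Finset.range (j + 1), (1 - q * q ^ i)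

theorem one_sub_q_mul_pow_ne_zero {q : ℂ} (hq : ‖q‖ < 1) (i : ℕ) : 1 - q * q ^ i ≠ 0 :=
  one_sub_ne_zero_of_norm_lt (norm_mul_pow_lt_one hq hq i)

/-- Completing the square: -kj + ((k+j)/2)² = (k-j)²/4. The growing factor q^{-kj} is absorbed in
the Gaussian, and what remains is bounded in j. -/
theorem jacksonWeight_mul_gauss {q k : ℂ} (hq0 : q ≠ 0) (j : ℕ) :
    jacksonWeight q k j * q ^ (((k + j) / 2) ^ 2) =
      q ^ ((k - (j : ℤ)) ^ 2 / 4) * gaussWeight q (q ^ k) j := by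
  cases j with
  | zero =>
    simp only [jacksonWeight, gaussWeight]
    push_cast
    ring_nf
  | succ j =>
    have e : ∏ l ∈ Finset.Icc 2 (j + 1), (1 - q ^ ((l : ℂ) + 2 * k - 1)) / (1 - q ^ l) =
        ∏ i ∈ Finset.range j, (1 - (q ^ k) ^ 2 * q * q ^ i) / (1 - q * q ^ (i + 1)) := by
      rw [show Finset.Icc 2 (j + 1) = Finset.Ico 2 (j + 2) from rfl, Finset.prod_Ico_eq_prod_range]
      refine Finset.prod_congr (by simp) fun i _ => ?_
      rw [show ((2 + i : ℕ) : ℂ) + 2 * k - 1 = ((i + 1 : ℕ) : ℂ) + (2 : ℕ) * k by push_cast; ring,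
        cpow_natCast_add hq0, Complex.cpow_nat_mul]
      ring
    have e2 : q ^ ((k - ((j + 1 : ℕ) : ℤ)) ^ 2 / 4) = q ^ (-k * ((j + 1 : ℕ) : ℂ)) *
        q ^ (((k + (j + 1 : ℕ)) / 2) ^ 2) := by
      rw [← Complex.cpow_add _ _ hq0]
      push_cast
      ring_nf
    rw [jacksonWeight, gaussWeight, e, e2, Finset.prod_div_distrib, Finset.prod_range_succ',
      cpow_natCast_add hq0, pow_zero, mul_one]
    simp only [div_eq_mul_inv, mul_inv]
    ring

/-- Uniformity in |s| ≤ |t| provides one constant for all parameters s = t q^N. -/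
theorem exists_bound_gaussWeight {q : ℂ} (hq : ‖q‖ < 1) (t : ℂ) :
    ∃ C, ∀ s : ℂ, ‖s‖ ≤ ‖t‖ → ∀ j, ‖gaussWeight q s j‖ ≤ C := by
  have hQ := ((hasProd_qPoch hq q).tendsto_prod_nat.inv₀ (qPoch_ne_zero_of_norm_lt_one hq hq))
  obtain ⟨c, hc⟩ := (Metric.isBounded_range_of_tendsto _ hQ).exists_norm_le
  have hc0 : 0 ≤ c := (norm_nonneg _).trans (hc _ ⟨0, rfl⟩)
  refine ⟨max 1 ((1 + ‖t‖) * (1 + ‖t‖) * Real.exp (‖t‖ ^ 2 * ‖q‖ * (1 - ‖q‖)⁻¹) * c),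
    fun s hs j => ?_⟩
  cases j with
  | zero => simp [gaussWeight]
  | succ j =>
    refine le_trans ?_ (le_max_right _ _)
    rw [gaussWeight, div_eq_mul_inv, norm_mul, norm_mul, norm_mul]
    have h1 : ‖1 - s * q ^ (j + 1)‖ ≤ 1 + ‖t‖ := by
      refine (norm_sub_le _ _).trans ?_
      rw [norm_one, norm_mul, norm_pow]
      have := pow_le_one₀ (n := j + 1) (norm_nonneg _) hq.le
      have : ‖s‖ * ‖q‖ ^ (j + 1) ≤ ‖t‖ * 1 := by gcongr
      linarith
    have h2 : ‖1 + s‖ ≤ 1 + ‖t‖ := by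
      refine (norm_add_le _ _).trans ?_
      rw [norm_one]
      linarith
    have h3 := norm_prod_one_sub_mul_pow_le hq (x := s ^ 2 * q) (X := ‖t‖ ^ 2 * ‖q‖) (by
      rw [norm_mul, norm_pow]; gcongr) j
    have h4 := hc _ ⟨j + 1, rfl⟩
    gcongr

theorem summable_gauss_shift {q : ℂ} (hq0 : q ≠ 0) (hq : ‖q‖ < 1) (k : ℂ) :
    Summable fun n : ℤ => q ^ ((k + n) ^ 2 / 4) := by
  refine ((summable_zpow_sq_mul_zpow (norm_cpow_inv_natCast_lt_one hq 4 (by norm_num))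
    (q ^ (k / 2))).mul_left (q ^ (k ^ 2 / 4))).congr fun n => ?_
  rw [← cpow_int_sq_div_four, ← Complex.cpow_int_mul, ← Complex.cpow_add _ _ hq0,
    ← Complex.cpow_add _ _ hq0]
  ring_nf

theorem summable_gauss_sub {q : ℂ} (hq0 : q ≠ 0) (hq : ‖q‖ < 1) (k : ℂ) :
    Summable fun n : ℤ => q ^ ((k - n) ^ 2 / 4) := by
  refine ((Equiv.neg ℤ).summable_iff.2 (summable_gauss_shift hq0 hq k)).congr fun n => ?_
  simp [sub_eq_add_neg]

theorem summable_gauss_mul_of_bounded {q : ℂ} (hq0 : q ≠ 0) (hq : ‖q‖ < 1) (k : ℂ) {w : ℕ → ℂ}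
    {C : ℝ} (hw : ∀ j, ‖w j‖ ≤ C) :
    Summable fun j : ℕ => q ^ ((k - (j : ℤ)) ^ 2 / 4) * w j := by
  have h := ((summable_gauss_sub hq0 hq k).norm.comp_injective
    (Nat.cast_injective (R := ℤ))).mul_right C
  refine Summable.of_norm_bounded h fun j => ?_
  rw [norm_mul]
  exact mul_le_mul_of_nonneg_left (hw j) (norm_nonneg _)

/-- The Gauss sum `∑_j q^{(k-j)²/4} W_j(q^k)`. -/
noncomputable def jacksonGauss (q k : ℂ) : ℂ :=
  ∑' j : ℕ, q ^ ((k - (j : ℤ)) ^ 2 / 4) * gaussWeight q (q ^ k) j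

/-- The telescoping certificate for the recurrence of the Gauss sum. -/
noncomputable def gaussCert (q t : ℂ) : ℕ → ℂ
  | 0 => 0
  | 1 => t * (1 - t * q)
  | (j + 2) => (t - t ^ 2 * q - t ^ 3 * q + t ^ 4 * q * q ^ (j + 2)) *
      (∏ i ∈ Finset.range j, (1 - t ^ 2 * q ^ 2 * q ^ i)) /
        ∏ i ∈ Finset.range (j + 1), (1 - q * q ^ i)

/-- The common factor q^{(k-j)²/4} has been divided out. The certificate moves by two places because
q^{(k-j-2)²/4} / q^{(k-j)²/4} = q^{j+1}/t is rational in t and q^j, whereas one place would bring in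
fractional powers. -/
theorem gaussCert_step {q t : ℂ} (hq : ‖q‖ < 1) (ht : t ≠ 0) (j : ℕ) :
    (1 - t * q) * gaussWeight q (t * q) (j + 1) - gaussWeight q t j =
      q ^ (j + 1) / t * gaussCert q t (j + 2) - gaussCert q t j := by
  have hQ : ∀ n, ∏ i ∈ Finset.range n, (1 - q * q ^ i) ≠ 0 := fun n =>
    Finset.prod_ne_zero_iff.2 fun i _ => one_sub_q_mul_pow_ne_zero hq i
  rcases j with _ | _ | j
  · have h := hQ 1
    simp only [gaussWeight, gaussCert, Finset.prod_range_succ, Finset.prod_range_zero] at h ⊢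
    norm_num at h ⊢
    field_simp
    ring
  · have h := hQ 2
    have h1 := one_sub_q_mul_pow_ne_zero hq 0
    have h2 := one_sub_q_mul_pow_ne_zero hq 1
    simp only [gaussWeight, gaussCert, Finset.prod_range_succ, Finset.prod_range_zero] at h ⊢
    norm_num at h h1 h2 ⊢
    rw [← pow_two] at h2 ⊢
    field_simp
    ring
  · have h1 := hQ (j + 1)
    have h2 := one_sub_q_mul_pow_ne_zero hq (j + 1)
    have h3 := one_sub_q_mul_pow_ne_zero hq (j + 2)
    have e1 : (1 - t ^ 2 * q ^ 2) * ∏ i ∈ Finset.range (j + 2), (1 - (t * q) ^ 2 * q * q ^ i) =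
        (∏ i ∈ Finset.range j, (1 - t ^ 2 * q ^ 2 * q ^ i)) * (1 - t ^ 2 * q ^ 2 * q ^ j) *
          (1 - t ^ 2 * q ^ 2 * q ^ (j + 1)) * (1 - t ^ 2 * q ^ 2 * q ^ (j + 2)) := by
      rw [← Finset.prod_range_succ, ← Finset.prod_range_succ, ← Finset.prod_range_succ,
        Finset.prod_range_succ' (fun i => 1 - t ^ 2 * q ^ 2 * q ^ i) (j + 2), mul_comm]
      congr 1
      · exact Finset.prod_congr rfl fun i _ => by ring
      · simp
    have e2 : (∏ i ∈ Finset.range (j + 1), (1 - t ^ 2 * q * q ^ i)) =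
        (1 - t ^ 2 * q) * (∏ i ∈ Finset.range j, (1 - t ^ 2 * q ^ 2 * q ^ i)) := by
      rw [Finset.prod_range_succ', mul_comm]
      congr 1
      · simp
      · exact Finset.prod_congr rfl fun i _ => by ring
    simp only [gaussWeight, gaussCert]
    rw [e2]
    -- (1 - tq)(1 + tq) supplies the leading factor 1 - t²q² that the product at tq lacks.
    have e3 : ∀ A X D : ℂ, (1 - t * q) * (A * (1 + t * q) * X / D) =
        A * ((1 - t ^ 2 * q ^ 2) * X) / D := fun A X D => by ring
    rw [e3, e1]
    simp only [Finset.prod_range_succ _ (j + 2), Finset.prod_range_succ _ (j + 1)]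
    simp only [Finset.prod_range_succ (fun i => 1 - t ^ 2 * q ^ 2 * q ^ i) j]
    generalize ∏ i ∈ Finset.range j, (1 - t ^ 2 * q ^ 2 * q ^ i) = P at *
    generalize ∏ i ∈ Finset.range (j + 1), (1 - q * q ^ i) = Q at *
    have h2' : 1 - q ^ 2 * q ^ j ≠ 0 := by convert h2 using 1; ring
    have h3' : 1 - q ^ 3 * q ^ j ≠ 0 := by convert h3 using 1; ring
    simp only [pow_succ q (j + 3), pow_succ q (j + 2), pow_succ q (j + 1), pow_succ q j]
    rw [show 1 - q * (q ^ j * q) = 1 - q ^ 2 * q ^ j by ring,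
      show 1 - q * (q ^ j * q * q) = 1 - q ^ 3 * q ^ j by ring]
    generalize q ^ j = u at *
    field_simp
    ring

theorem exists_bound_gaussCert {q : ℂ} (hq : ‖q‖ < 1) (t : ℂ) :
    ∃ C, ∀ j, ‖gaussCert q t j‖ ≤ C := by
  have hq' := tendsto_pow_atTop_nhds_zero_of_norm_lt_one hq
  have h1 := (((((tendsto_add_atTop_iff_nat 2).2 hq').const_mul (t ^ 4 * q)).const_add
    (t - t ^ 2 * q - t ^ 3 * q)).mul (hasProd_qPoch hq (t ^ 2 * q ^ 2)).tendsto_prod_nat).div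
    ((hasProd_qPoch hq q).tendsto_prod_nat.comp (tendsto_add_atTop_nat 1))
    (qPoch_ne_zero_of_norm_lt_one hq hq)
  have h2 : Tendsto (gaussCert q t) atTop _ := (tendsto_add_atTop_iff_nat 2).1 h1
  obtain ⟨C, hC⟩ := (Metric.isBounded_range_of_tendsto _ h2).exists_norm_le
  exact ⟨C, fun j => hC _ ⟨j, rfl⟩⟩

/-- With j shifted by one in J(k+1), both sums carry the Gaussian q^{(k-j)²/4}, and `gaussCert_step`
telescopes their difference. -/
theorem jacksonGauss_eq_mul {q k : ℂ} (hq0 : q ≠ 0) (hq : ‖q‖ < 1) :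
    jacksonGauss q k = (1 - q ^ k * q) * jacksonGauss q (k + 1) := by
  set t := q ^ k with ht_def
  have ht : t ≠ 0 := by simp [ht_def, Complex.cpow_eq_zero_iff, hq0]
  have ht1 : q ^ (k + 1) = t * q := by rw [Complex.cpow_add _ _ hq0, Complex.cpow_one]
  obtain ⟨C, hC⟩ := exists_bound_gaussWeight hq t
  obtain ⟨C', hC'⟩ := exists_bound_gaussWeight hq (t * q)
  have hJ : HasSum _ (jacksonGauss q k) :=
    (summable_gauss_mul_of_bounded hq0 hq k (hC t le_rfl)).hasSum
  have hJ' := (summable_gauss_mul_of_bounded hq0 hq (k + 1) (hC' (t * q) le_rfl)).hasSum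
  have hJ'' : ∑' j : ℕ, q ^ ((k + 1 - (j : ℤ)) ^ 2 / 4) * gaussWeight q (t * q) j =
      jacksonGauss q (k + 1) := by rw [jacksonGauss, ht1]
  rw [hJ''] at hJ'
  obtain ⟨D, hD⟩ := exists_bound_gaussCert hq t
  have hG := (summable_gauss_mul_of_bounded hq0 hq k hD).hasSum
  have hG2 := (hasSum_nat_add_iff' 2).2 hG
  have h1 := (((hasSum_nat_add_iff' 1).2 hJ').mul_left (1 - t * q)).sub hJ
  have h2 := h1.unique ((hG2.sub hG).of_eq_of_eq (fun j => ?_) rfl)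
  · simp only [Finset.sum_range_succ, Finset.sum_range_zero, gaussCert, gaussWeight] at h2
    -- The term j = 0 that the shift drops from J(k+1) cancels the boundary value of the certificate
    -- at index 1.
    have e : q ^ ((k + 1) ^ 2 / 4) = q ^ ((k - 1) ^ 2 / 4) * t := by
      rw [ht_def, ← Complex.cpow_add _ _ hq0]; ring_nf
    norm_num [e] at h2
    linear_combination -h2
  · have e1 : q ^ ((k + 1 - ((j + 1 : ℕ) : ℤ)) ^ 2 / 4) = q ^ ((k - (j : ℤ)) ^ 2 / 4) := by
      push_cast; ring_nf
    have e2 : q ^ ((k - ((j + 2 : ℕ) : ℤ)) ^ 2 / 4) =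
        q ^ ((k - (j : ℤ)) ^ 2 / 4) * (q ^ (j + 1) / t) := by
      rw [ht_def, ← Complex.cpow_natCast q (j + 1), ← Complex.cpow_sub _ _ hq0,
        ← Complex.cpow_add _ _ hq0]
      push_cast
      ring_nf
    rw [e1, e2]
    linear_combination q ^ ((k - (j : ℤ)) ^ 2 / 4) * gaussCert_step hq ht j

theorem jacksonGauss_eq_prod_mul {q : ℂ} (hq0 : q ≠ 0) (hq : ‖q‖ < 1) (k : ℂ) (N : ℕ) :
    jacksonGauss q k = (∏ j ∈ Finset.range N, (1 - q ^ k * q * q ^ j)) *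
      jacksonGauss q (k + N) := by
  induction N with
  | zero => simp
  | succ N ih =>
    rw [ih, jacksonGauss_eq_mul hq0 hq, Finset.prod_range_succ, Complex.cpow_add _ _ hq0,
      Complex.cpow_natCast]
    push_cast
    ring_nf

/-- `gaussWeight` extended by zero to negative indices. -/
noncomputable def gaussWeightInt (q t : ℂ) (n : ℤ) : ℂ :=
  if 0 ≤ n then gaussWeight q t n.toNat else 0

/-- Recentring by n = m + N makes the Gaussian independent of N; only the bounded weight still
varies, and the range of m grows to all of ℤ. -/
theorem jacksonGauss_add_natCast {q : ℂ} (hq0 : q ≠ 0) (k : ℂ) (N : ℕ) :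
    jacksonGauss q (k + N) =
      ∑' m : ℤ, q ^ ((k - m) ^ 2 / 4) * gaussWeightInt q (q ^ k * q ^ N) (m + N) := by
  have e : q ^ (k + N) = q ^ k * q ^ N := by
    rw [Complex.cpow_add _ _ hq0, Complex.cpow_natCast]
  have h := (Nat.cast_injective (R := ℤ)).tsum_eq (f := fun n : ℤ =>
    q ^ ((k + N - n) ^ 2 / 4) * gaussWeightInt q (q ^ k * q ^ N) n) (fun n hn => by
      by_contra h
      refine hn ?_
      have : ¬ 0 ≤ n := fun h0 => h ⟨n.toNat, Int.toNat_of_nonneg h0⟩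
      simp [gaussWeightInt, this])
  rw [← (Equiv.addRight (N : ℤ)).tsum_eq] at h
  rw [jacksonGauss, e]
  refine (tsum_congr fun j => ?_).trans (h.trans (tsum_congr fun m => ?_))
  · simp [gaussWeightInt]
  · simp only [Equiv.coe_addRight]
    push_cast
    ring_nf

theorem tendsto_gaussWeightInt {q : ℂ} (hq : ‖q‖ < 1) (t : ℂ) (m : ℤ) :
    Tendsto (fun N : ℕ => gaussWeightInt q (t * q ^ N) (m + N)) atTop (𝓝 (qPoch q q)⁻¹) := by
  have hq' := tendsto_pow_atTop_nhds_zero_of_norm_lt_one hq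
  have hj : Tendsto (fun N : ℕ => (m + N - 1).toNat) atTop atTop := by
    refine tendsto_atTop.2 fun b => ?_
    filter_upwards [eventually_ge_atTop (b + 1 + m.natAbs)] with N hN
    omega
  have ht : Tendsto (fun N : ℕ => t * q ^ N) atTop (𝓝 0) := by simpa using hq'.const_mul t
  have hV : Tendsto (fun N : ℕ => ∏ i ∈ Finset.range (m + N - 1).toNat,
      (1 - (t * q ^ N) ^ 2 * q * q ^ i)) atTop (𝓝 1) := by
    rw [tendsto_iff_norm_sub_tendsto_zero]
    refine squeeze_zero (fun _ => norm_nonneg _)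
      (fun N => norm_prod_one_sub_mul_pow_sub_one_le hq _ _) ?_
    have h1 : Tendsto (fun N : ℕ => ‖(t * q ^ N) ^ 2 * q‖ * (1 - ‖q‖)⁻¹) atTop (𝓝 0) := by
      simpa using (((ht.pow 2).mul_const q).norm).mul_const (1 - ‖q‖)⁻¹
    simpa using ((Real.continuous_exp.tendsto 0).comp h1).sub_const 1
  have h := ((((ht.mul ((hq'.comp (tendsto_add_atTop_nat 1)).comp hj)).const_sub 1).mul
    (ht.const_add 1)).mul hV).div ((hasProd_qPoch hq q).tendsto_prod_nat.comp
      ((tendsto_add_atTop_nat 1).comp hj)) (qPoch_ne_zero_of_norm_lt_one hq hq)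
  simp only [mul_zero, sub_zero, add_zero, mul_one, one_div] at h
  refine h.congr' ?_
  filter_upwards [eventually_ge_atTop (m.natAbs + 1)] with N hN
  obtain ⟨j, hj⟩ : ∃ j : ℕ, m + N = ((j + 1 : ℕ) : ℤ) := ⟨(m + N - 1).toNat, by omega⟩
  have hj' : (m + N - 1).toNat = j := by omega
  rw [gaussWeightInt, if_pos (by omega), hj, Int.toNat_natCast, gaussWeight]
  simp only [Pi.div_apply, Function.comp, hj']

theorem jacksonGauss_eq {q : ℂ} (hq0 : q ≠ 0) (hq : ‖q‖ < 1) (k : ℂ) :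
    jacksonGauss q k = qPoch q (q ^ k * q) / qPoch q q * ∑' n : ℤ, q ^ ((k + n) ^ 2 / 4) := by
  obtain ⟨C, hC⟩ := exists_bound_gaussWeight hq (q ^ k)
  have hC0 : 0 ≤ C := (norm_nonneg _).trans (hC _ le_rfl 0)
  have h1 : Tendsto (fun N : ℕ => jacksonGauss q (k + N)) atTop
      (𝓝 (∑' m : ℤ, q ^ ((k - m) ^ 2 / 4) * (qPoch q q)⁻¹)) := by
    simp_rw [jacksonGauss_add_natCast hq0]
    refine tendsto_tsum_of_dominated_convergence
      ((summable_gauss_sub hq0 hq k).norm.mul_right C)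
      (fun m => (tendsto_gaussWeightInt hq _ m).const_mul _) (.of_forall fun N m => ?_)
    rw [norm_mul]
    refine mul_le_mul_of_nonneg_left ?_ (norm_nonneg _)
    rw [gaussWeightInt]
    split_ifs
    · refine hC _ ?_ _
      rw [norm_mul, norm_pow]
      exact mul_le_of_le_one_right (norm_nonneg _) (pow_le_one₀ (norm_nonneg _) hq.le)
    · simpa using hC0
  have h2 := ((hasProd_qPoch hq (q ^ k * q)).tendsto_prod_nat.mul h1).congr fun N =>
    (jacksonGauss_eq_prod_mul hq0 hq k N).symm
  rw [tendsto_nhds_unique tendsto_const_nhds h2, tsum_mul_right, ← (Equiv.neg ℤ).tsum_eq]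
  simp only [Equiv.neg_apply, Int.cast_neg, sub_neg_eq_add]
  ring

/-- In base r² the coefficient at t = 0 is (-1)^n r^{n(n-1)}, so the triple product becomes a
symmetric theta series. -/
theorem psiCoeff_zero_mul_zpow {r : ℂ} (hr : r ≠ 0) (n : ℤ) :
    psiCoeff (r ^ 2) 0 n * (-r) ^ n = r ^ (n ^ 2) := by
  have key : ∀ m : ℕ, psiNat (r ^ 2) 0 m * (-r) ^ m = r ^ (m ^ 2) := by
    intro m
    induction m with
    | zero => simp
    | succ m ih =>
      rw [psiNat_succ, show r ^ ((m + 1) ^ 2) = r ^ (m ^ 2) * r ^ (2 * m) * r by ring, ← ih]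
      simp only [zero_mul, sub_zero, div_one]
      ring
  obtain ⟨m, rfl | rfl⟩ := n.eq_nat_or_neg
  · rw [psiCoeff_natCast, zpow_natCast, key]
    norm_cast
  · have h1 : (-r) ^ m ≠ 0 := pow_ne_zero _ (neg_ne_zero.2 hr)
    have h2 : (r ^ 2) ^ m = (-r) ^ m * (-r) ^ m := by
      rw [← mul_pow]; ring
    rw [psiCoeff_neg_natCast, zpow_neg, zpow_natCast, h2, neg_sq]
    have := key m
    rw [show r ^ ((m : ℤ) ^ 2) = r ^ (m ^ 2) by norm_cast, ← this]
    field_simp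

theorem tsum_zpow_sq_mul_zpow {r y : ℂ} (hr0 : r ≠ 0) (hr : ‖r‖ < 1) (hy : y ≠ 0) :
    ∑' n : ℤ, r ^ (n ^ 2) * y ^ n =
      qPoch (r ^ 2) (r ^ 2) * (qPoch (r ^ 2) (-(r * y)) * qPoch (r ^ 2) (-(r / y))) := by
  have hp : ‖r ^ 2‖ < 1 := by rw [norm_pow]; exact pow_lt_one₀ (norm_nonneg _) hr two_ne_zero
  have h := tsum_psiCoeff_zero_mul_zpow (pow_ne_zero 2 hr0) hp
    (neg_ne_zero.2 (mul_ne_zero hr0 hy))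
  rw [show r ^ 2 / -(r * y) = -(r / y) by field_simp] at h
  rw [← h]
  refine tsum_congr fun n => ?_
  rw [← psiCoeff_zero_mul_zpow hr0, ← neg_mul, mul_zpow, mul_assoc]

theorem jacksonSum_gauss_evaluation {q : ℂ} (hq0 : q ≠ 0) (hq : ‖q‖ < 1) (k : ℂ) :
      Summable (fun j : ℕ => jacksonWeight q k j * q ^ (((k + j) / 2) ^ 2)) ∧
      Summable (fun j : ℤ => q ^ ((k + j) ^ 2 / 4)) ∧
      jacksonSum q k (fun x => q ^ (x ^ 2)) =
        (∏' j : ℕ, (1 - q ^ ((j : ℂ) + 1 + k)) / (1 - q ^ ((j : ℂ) + 1))) *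
          ∑' j : ℤ, q ^ ((k + j) ^ 2 / 4) ∧
      jacksonSum q k (fun x => q ^ (x ^ 2)) =
        q ^ (k ^ 2 / 4) *
          ∏' j : ℕ, ((1 - q ^ (((j : ℂ) + 1) / 2)) * (1 - q ^ ((j : ℂ) + 1 + k)) *
            (1 + q ^ (((j : ℂ) + 1) / 2 - 1 / 4 + k / 2)) *
            (1 + q ^ (((j : ℂ) + 1) / 2 - 1 / 4 - k / 2))) /
            (1 - q ^ ((j : ℂ) + 1)) := by
  obtain ⟨C, hC⟩ := exists_bound_gaussWeight hq (q ^ k)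
  have n1 := qPoch_ne_zero_of_norm_lt_one hq hq
  have hJ : jacksonSum q k (fun x => q ^ (x ^ 2)) =
      qPoch q (q ^ k * q) / qPoch q q * ∑' n : ℤ, q ^ ((k + n) ^ 2 / 4) := by
    rw [← jacksonGauss_eq hq0 hq]
    exact tsum_congr fun j => jacksonWeight_mul_gauss hq0 j
  have e1 : ∀ j : ℕ, q ^ ((j : ℂ) + 1 + k) = q ^ k * q * q ^ j := fun j => by
    rw [add_assoc, cpow_natCast_add hq0, Complex.cpow_add _ _ hq0, Complex.cpow_one, mul_comm q]
  have e2 : ∀ j : ℕ, q ^ ((j : ℂ) + 1) = q * q ^ j := fun j => by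
    rw [cpow_natCast_add hq0, Complex.cpow_one]
  refine ⟨?_, summable_gauss_shift hq0 hq k, ?_, ?_⟩
  · exact (summable_gauss_mul_of_bounded hq0 hq k (hC _ le_rfl)).congr fun j =>
      (jacksonWeight_mul_gauss hq0 j).symm
  · simp_rw [hJ, e1, e2, tprod_two_div hq n1]
  -- r = q^{1/4} makes r^{n²} = q^{n²/4}, and the base of the triple product is r² = q^{1/2}.
  · set r := q ^ (((4 : ℕ) : ℂ)⁻¹) with hr_def
    have hr0 : r ≠ 0 := by simp [hr_def, Complex.cpow_eq_zero_iff, hq0]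
    have hr : ‖r‖ < 1 := norm_cpow_inv_natCast_lt_one hq 4 (by norm_num)
    have hp : ‖r ^ 2‖ < 1 := by rw [norm_pow]; exact pow_lt_one₀ (norm_nonneg _) hr two_ne_zero
    have hy0 : q ^ (k / 2) ≠ 0 := by simp [Complex.cpow_eq_zero_iff, hq0]
    have hθ : ∑' n : ℤ, q ^ ((k + n) ^ 2 / 4) = q ^ (k ^ 2 / 4) *
        ∑' n : ℤ, r ^ (n ^ 2) * (q ^ (k / 2)) ^ n := by
      rw [← tsum_mul_left]
      refine tsum_congr fun n => ?_
      rw [← cpow_int_sq_div_four, ← Complex.cpow_int_mul, ← Complex.cpow_add _ _ hq0,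
        ← Complex.cpow_add _ _ hq0]
      ring_nf
    have e3 : ∀ (j : ℕ) (s : ℂ), q ^ ((j : ℂ) / 2 + s) = q ^ s * (r ^ 2) ^ j := fun j s => by
      rw [Complex.cpow_add _ _ hq0, mul_comm, hr_def, ← pow_mul, ← Complex.cpow_nat_mul]
      congr 2
      push_cast
      ring
    have e4 : r ^ 2 = q ^ (1 / 2 : ℂ) := by
      rw [hr_def, ← Complex.cpow_nat_mul]
      norm_num
    have e5 : r * q ^ (k / 2) = q ^ (1 / 4 + k / 2) := by
      rw [hr_def, ← Complex.cpow_add _ _ hq0]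
      norm_num
    have e6 : r / q ^ (k / 2) = q ^ (1 / 4 - k / 2) := by
      rw [hr_def, ← Complex.cpow_sub _ _ hq0]
      norm_num
    have hprod := ((((hasProd_qPoch hp (r ^ 2)).mul (hasProd_qPoch hq (q ^ k * q))).mul
      (hasProd_qPoch hp (-(r * q ^ (k / 2))))).mul (hasProd_qPoch hp (-(r / q ^ (k / 2))))).mul
      ((hasProd_qPoch hq q).inv₀ n1)
    rw [hJ, hθ, tsum_zpow_sq_mul_zpow hr0 hr hy0]
    refine Eq.trans ?_ (congrArg (q ^ (k ^ 2 / 4) * ·)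
      (hprod.tprod_eq.symm.trans (tprod_congr fun j => ?_)))
    · ring
    · rw [e1, e2, div_eq_mul_inv _ (1 - q * q ^ j),
        show ((j : ℂ) + 1) / 2 = j / 2 + 1 / 2 by ring,
        show (j : ℂ) / 2 + 1 / 2 - 1 / 4 + k / 2 = j / 2 + (1 / 4 + k / 2) by ring,
        show (j : ℂ) / 2 + 1 / 2 - 1 / 4 - k / 2 = j / 2 + (1 / 4 - k / 2) by ring, e3, e3, e3,
        e5, e6, ← e4]
      ring

/-! ### The residue theorem on a rectangle. -/

theorem Complex.log_neg_of_im_pos {u : ℂ} (h : 0 < u.im) :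
    Complex.log (-u) = Complex.log u - Real.pi * Complex.I := by
  rw [Complex.log, Complex.log, norm_neg, Complex.arg_neg_eq_arg_sub_pi_of_im_pos h]
  push_cast
  ring

theorem Complex.log_neg_of_im_neg {u : ℂ} (h : u.im < 0) :
    Complex.log (-u) = Complex.log u + Real.pi * Complex.I := by
  rw [Complex.log, Complex.log, norm_neg, Complex.arg_neg_eq_arg_add_pi_of_im_neg h]
  push_cast
  ring

/-- The integral of `f` along the boundary of the rectangle with corners `a + c i` and `b + d i`. -/
noncomputable def rectIntegral (f : ℂ → ℂ) (a b c d : ℝ) : ℂ :=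
  (∫ x : ℝ in a..b, f (x + c * Complex.I)) - (∫ x : ℝ in a..b, f (x + d * Complex.I)) +
    Complex.I * (∫ y : ℝ in c..d, f (b + y * Complex.I)) -
    Complex.I * (∫ y : ℝ in c..d, f (a + y * Complex.I))

theorem integral_inv_of_mem_slitPlane {u : ℝ → ℂ} {v σ : ℂ} {a b : ℝ} (hσ : σ ≠ 0)
    (hu : ∀ x, HasDerivAt u v x) (hs : ∀ x ∈ Set.uIcc a b, σ * u x ∈ Complex.slitPlane) :
    v * ∫ x in a..b, (u x)⁻¹ = Complex.log (σ * u b) - Complex.log (σ * u a) := by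
  have hu0 : ∀ x ∈ Set.uIcc a b, u x ≠ 0 := fun x hx h => by
    have := hs x hx
    rw [h, mul_zero] at this
    exact Complex.slitPlane_ne_zero this rfl
  have hc : Continuous u := continuous_iff_continuousAt.2 fun x => (hu x).continuousAt
  rw [← intervalIntegral.integral_const_mul]
  refine intervalIntegral.integral_eq_sub_of_hasDerivAt
    (f := fun x => Complex.log (σ * u x)) (fun x hx => ?_) ?_
  · have h := ((hu x).const_mul σ).clog_real (hs x hx)
    have h0 := hu0 x hx
    rwa [mul_div_mul_left _ _ hσ, div_eq_mul_inv] at h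
  · exact ((hc.continuousOn.inv₀ hu0).const_mul v).intervalIntegrable

/-- The principal logarithm of x - p is a primitive on the bottom, right and top sides. The left
side crosses its cut, so log(p - x) is used there; the mismatch is πi at each of the two left
corners. -/
theorem rectIntegral_inv_sub {a b c d : ℝ} {p : ℂ} (h1 : a < p.re) (h2 : p.re < b)
    (h3 : c < p.im) (h4 : p.im < d) :
    rectIntegral (fun x => (x - p)⁻¹) a b c d = 2 * Real.pi * Complex.I := by
  have hh : ∀ c : ℝ, ∀ x : ℝ, HasDerivAt (fun x : ℝ => (x : ℂ) + c * Complex.I - p) 1 x :=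
    fun c x => ((Complex.ofRealCLM.hasDerivAt (x := x)).add_const _).sub_const _
  have hv : ∀ a : ℝ, ∀ y : ℝ,
      HasDerivAt (fun y : ℝ => (a : ℂ) + y * Complex.I - p) Complex.I y := fun a y => by
    simpa using (((Complex.ofRealCLM.hasDerivAt (x := y)).mul_const Complex.I).const_add
      (a : ℂ)).sub_const p
  have i1 := integral_inv_of_mem_slitPlane (a := a) (b := b) one_ne_zero (hh c) fun x _ => by
    rw [Complex.mem_slitPlane_iff]; right; simp; intro h; linarith
  have i2 := integral_inv_of_mem_slitPlane (a := a) (b := b) one_ne_zero (hh d) fun x _ => by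
    rw [Complex.mem_slitPlane_iff]; right; simp; intro h; linarith
  have i3 := integral_inv_of_mem_slitPlane (a := c) (b := d) one_ne_zero (hv b) fun x _ => by
    rw [Complex.mem_slitPlane_iff]; left; simp; linarith
  have i4 := integral_inv_of_mem_slitPlane (a := c) (b := d) (neg_ne_zero.2 one_ne_zero) (hv a)
    fun x _ => by rw [Complex.mem_slitPlane_iff]; left; simp; linarith
  simp only [one_mul, neg_one_mul] at i1 i2 i3 i4
  rw [Complex.log_neg_of_im_pos (u := (a : ℂ) + d * Complex.I - p) (by simp; linarith),
    Complex.log_neg_of_im_neg (u := (a : ℂ) + c * Complex.I - p) (by simp; linarith)] at i4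
  rw [rectIntegral, i1, i2, i3, i4]
  ring

/-- The residue theorem for a rectangle and a simple pole. -/
theorem rectIntegral_eq_of_simple_pole {f H : ℂ → ℂ} {a b c d : ℝ} {p : ℂ}
    (h1 : a < p.re) (h2 : p.re < b) (h3 : c < p.im) (h4 : p.im < d)
    (hH : ∀ x ∈ Set.Icc a b ×ℂ Set.Icc c d, DifferentiableAt ℂ H x)
    (hf : ∀ x ∈ Set.Icc a b ×ℂ Set.Icc c d, x ≠ p → f x = H x / (x - p)) :
    rectIntegral f a b c d = 2 * Real.pi * Complex.I * H p := by
  have hab : a ≤ b := (h1.trans h2).le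
  have hcd : c ≤ d := (h3.trans h4).le
  have hp : Set.Icc a b ×ℂ Set.Icc c d ∈ 𝓝 p :=
    mem_of_superset ((isOpen_Ioo.reProdIm isOpen_Ioo).mem_nhds
      (show p ∈ Set.Ioo a b ×ℂ Set.Ioo c d from ⟨⟨h1, h2⟩, ⟨h3, h4⟩⟩))
      (Set.preimage_mono (f := id) (Complex.reProdIm_subset_iff'.2
        (Or.inl ⟨Set.Ioo_subset_Icc_self, Set.Ioo_subset_Icc_self⟩)))
  -- `dslope H p` is f minus its polar part, continued to p, so Cauchy's theorem with one
  -- exceptional point applies to it.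
  have hcont : ContinuousOn (dslope H p) (Set.Icc a b ×ℂ Set.Icc c d) :=
    (continuousOn_dslope hp).2
      ⟨fun x hx => (hH x hx).continuousAt.continuousWithinAt, hH p (mem_of_mem_nhds hp)⟩
  have hG : rectIntegral (dslope H p) a b c d = 0 := by
    have := Complex.integral_boundary_rect_eq_zero_of_differentiable_on_off_countable
      (dslope H p) ⟨a, c⟩ ⟨b, d⟩ {p} (Set.countable_singleton p)
      (by simpa only [Set.uIcc_of_le hab, Set.uIcc_of_le hcd] using hcont) (fun x hx => by
        rw [differentiableAt_dslope_of_ne hx.2]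
        refine hH x ⟨?_, ?_⟩
        · have := hx.1.1
          rw [min_eq_left hab, max_eq_right hab] at this
          exact Set.Ioo_subset_Icc_self this
        · have := hx.1.2
          rw [min_eq_left hcd, max_eq_right hcd] at this
          exact Set.Ioo_subset_Icc_self this)
    simpa [rectIntegral] using this
  have hfG : ∀ x ∈ Set.Icc a b ×ℂ Set.Icc c d, x ≠ p → f x = dslope H p x + H p * (x - p)⁻¹ := by
    intro x hx hxp
    have : x - p ≠ 0 := sub_ne_zero.2 hxp
    rw [hf x hx hxp, dslope_of_ne _ hxp, slope_def_field]
    field_simp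
    ring
  have side : ∀ (u : ℝ → ℂ) (α β : ℝ), α ≤ β → Continuous u →
      (∀ s ∈ Set.Icc α β, u s ∈ Set.Icc a b ×ℂ Set.Icc c d ∧ u s ≠ p) →
      ∫ s in α..β, f (u s) = (∫ s in α..β, dslope H p (u s)) +
        H p * ∫ s in α..β, (u s - p)⁻¹ := by
    intro u α β hαβ hu hs
    rw [← intervalIntegral.integral_const_mul, ← intervalIntegral.integral_add]
    · refine intervalIntegral.integral_congr fun s hs' => ?_
      rw [Set.uIcc_of_le hαβ] at hs'
      exact hfG _ (hs s hs').1 (hs s hs').2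
    · refine ContinuousOn.intervalIntegrable ?_
      rw [Set.uIcc_of_le hαβ]
      exact hcont.comp hu.continuousOn fun s hs' => (hs s hs').1
    · refine ContinuousOn.intervalIntegrable ?_
      rw [Set.uIcc_of_le hαβ]
      exact ((hu.continuousOn.sub continuousOn_const).inv₀ fun s hs' =>
        sub_ne_zero.2 (hs s hs').2).const_mul _
  have s1 := side (fun x => x + c * Complex.I) a b hab (by fun_prop) fun x hx =>
    ⟨by simpa [Complex.mem_reProdIm] using ⟨hx, hcd⟩, fun h => by
      rw [← h] at h3; simp at h3⟩
  have s2 := side (fun x => x + d * Complex.I) a b hab (by fun_prop) fun x hx =>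
    ⟨by simpa [Complex.mem_reProdIm] using ⟨hx, hcd⟩, fun h => by
      rw [← h] at h4; simp at h4⟩
  have s3 := side (fun y => b + y * Complex.I) c d hcd (by fun_prop) fun y hy =>
    ⟨by simpa [Complex.mem_reProdIm] using ⟨hab, hy⟩, fun h => by
      rw [← h] at h2; simp at h2⟩
  have s4 := side (fun y => a + y * Complex.I) c d hcd (by fun_prop) fun y hy =>
    ⟨by simpa [Complex.mem_reProdIm] using ⟨hab, hy⟩, fun h => by
      rw [← h] at h1; simp at h1⟩
  have hI := rectIntegral_inv_sub h1 h2 h3 h4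
  rw [rectIntegral] at hG hI ⊢
  rw [s1, s2, s3, s4]
  linear_combination hG + H p * hI

/-! ### Poles and residues of q^{x²} δ in the half-strip. -/

section Sharp

variable {q : ℂ} {a : ℝ}

theorem ne_zero_of_cpow_eq_exp (hpow : ∀ s : ℂ, q ^ s = Complex.exp (-(s / a))) : q ≠ 0 := by
  rw [← Complex.cpow_one q, hpow]
  exact Complex.exp_ne_zero _

theorem norm_cpow_of_cpow_eq_exp (hpow : ∀ s : ℂ, q ^ s = Complex.exp (-(s / a))) (s : ℂ) :
    ‖q ^ s‖ = Real.exp (-(s.re / a)) := by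
  rw [hpow, Complex.norm_exp, Complex.neg_re, Complex.div_ofReal_re]

theorem norm_cpow_lt_one_of_cpow_eq_exp (ha : 0 < a)
    (hpow : ∀ s : ℂ, q ^ s = Complex.exp (-(s / a))) {s : ℂ} (hs : 0 < s.re) : ‖q ^ s‖ < 1 := by
  rw [norm_cpow_of_cpow_eq_exp hpow, Real.exp_lt_one_iff]
  exact neg_lt_zero.2 (div_pos hs ha)

theorem norm_lt_one_of_cpow_eq_exp (ha : 0 < a)
    (hpow : ∀ s : ℂ, q ^ s = Complex.exp (-(s / a))) : ‖q‖ < 1 := by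
  simpa using norm_cpow_lt_one_of_cpow_eq_exp ha hpow (s := 1) (by simp)

theorem differentiable_const_cpow (hq : q ≠ 0) : Differentiable ℂ fun s : ℂ => q ^ s :=
  fun _ => DifferentiableAt.const_cpow differentiableAt_id (Or.inl hq)

/-- The integrand `q^{x²} δ(x; q, k)`. -/
noncomputable def gaussDelta (q k x : ℂ) : ℂ := q ^ (x ^ 2) * qDelta q k x

/-- The integrand `q^{x²} δ(x; q, k)` without the factor `1 / (1 - q^{n + k - 2x})`. -/
noncomputable def gaussDeltaReg (q k : ℂ) (n : ℕ) (x : ℂ) : ℂ :=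
  q ^ (x ^ 2) * ((qPoch q (q ^ (2 * x)) * qPoch q (q ^ (-2 * x))) / (qPoch q (q ^ (k + 2 * x)) *
    ((∏ i ∈ Finset.range n, (1 - q ^ (k - 2 * x) * q ^ i)) *
      qPoch q (q ^ (k - 2 * x) * q ^ (n + 1)))))

theorem gaussDelta_eq_reg_div (hq0 : q ≠ 0) (hq : ‖q‖ < 1) (k : ℂ) (n : ℕ) (x : ℂ) :
    gaussDelta q k x = gaussDeltaReg q k n x / (1 - q ^ (k - 2 * x) * q ^ n) := by
  rw [gaussDelta, gaussDeltaReg, qDelta_eq hq0 hq, qPoch_eq_prod_mul hq (q ^ (k - 2 * x)) n,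
    qPoch_succ hq (q ^ (k - 2 * x) * q ^ n), pow_succ]
  simp only [div_eq_mul_inv, mul_inv]
  ring_nf

/-- The solutions of q^{k+j-2x} = 1 are (k+j)/2 + πian for n ∈ ℤ. The smallness of ε keeps those
with n ≠ 0 out of the strip. -/
theorem cpow_sub_mul_pow_ne_one (ha : 0 < a) (hpow : ∀ s : ℂ, q ^ s = Complex.exp (-(s / a)))
    {k x : ℂ} {ε : ℝ} (hε : |k.im| + 2 * ε < 2 * Real.pi * a) (hx : |x.im| ≤ ε) (j : ℕ)
    (hxj : x ≠ (k + j) / 2) : q ^ (k - 2 * x) * q ^ j ≠ 1 := by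
  intro h
  rw [← cpow_natCast_add (ne_zero_of_cpow_eq_exp hpow), hpow, Complex.exp_eq_one_iff] at h
  obtain ⟨n, hn⟩ := h
  have ha' : (a : ℂ) ≠ 0 := by exact_mod_cast ha.ne'
  have h1 : 2 * x = k + j + n * (2 * Real.pi * a) * Complex.I := by
    field_simp at hn
    linear_combination hn
  have h2 : 2 * x.im = k.im + n * (2 * Real.pi * a) := by
    simpa using congrArg Complex.im h1
  have hpa : 0 < 2 * Real.pi * a := by positivity
  have h3 : |(n : ℝ)| * (2 * Real.pi * a) < 1 * (2 * Real.pi * a) := by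
    rw [one_mul, ← abs_of_pos hpa, ← abs_mul, abs_of_pos hpa,
      show (n : ℝ) * (2 * Real.pi * a) = 2 * x.im - k.im by linarith]
    refine (abs_sub _ _).trans_lt ?_
    rw [abs_mul, abs_two]
    linarith
  have h4 : n = 0 := by
    have := lt_of_mul_lt_mul_right h3 hpa.le
    exact Int.abs_lt_one_iff.1 (by exact_mod_cast this)
  refine hxj ?_
  rw [h4] at h1
  simp only [Int.cast_zero, zero_mul, add_zero] at h1
  rw [← h1]
  ring

theorem differentiableAt_gaussDeltaReg (ha : 0 < a)
    (hpow : ∀ s : ℂ, q ^ s = Complex.exp (-(s / a))) {k x : ℂ} {ε : ℝ} (hk : 0 < k.re)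
    (hε : |k.im| + 2 * ε < 2 * Real.pi * a) (hx : |x.im| ≤ ε) (hx0 : 0 ≤ x.re) (n : ℕ)
    (hxj : ∀ j : ℕ, j ≠ n → x ≠ (k + j) / 2) : DifferentiableAt ℂ (gaussDeltaReg q k n) x := by
  have hq0 := ne_zero_of_cpow_eq_exp hpow
  have hq := norm_lt_one_of_cpow_eq_exp ha hpow
  have hd := differentiable_const_cpow hq0
  have hP := differentiable_qPoch hq
  have d1 : ∀ g : ℂ → ℂ, Differentiable ℂ g → Differentiable ℂ fun x => q ^ g x :=
    fun g hg => hd.comp hg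
  have d2 : Differentiable ℂ fun x => q ^ (k - 2 * x) := d1 _ (by fun_prop)
  have n1 : qPoch q (q ^ (k + 2 * x)) ≠ 0 := by
    refine qPoch_ne_zero_of_norm_lt_one hq (norm_cpow_lt_one_of_cpow_eq_exp ha hpow ?_)
    simp
    linarith
  have n2 : ∏ i ∈ Finset.range n, (1 - q ^ (k - 2 * x) * q ^ i) ≠ 0 :=
    Finset.prod_ne_zero_iff.2 fun i hi => sub_ne_zero.2
      (cpow_sub_mul_pow_ne_one ha hpow hε hx i (hxj i (Finset.mem_range.1 hi).ne)).symm
  have n3 : qPoch q (q ^ (k - 2 * x) * q ^ (n + 1)) ≠ 0 := qPoch_ne_zero hq fun j => by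
    rw [mul_assoc, ← pow_add]
    exact cpow_sub_mul_pow_ne_one ha hpow hε hx _ (hxj _ (by omega))
  refine ((d1 _ (by fun_prop)) x).mul (DifferentiableAt.div ?_ ?_ (mul_ne_zero n1 (mul_ne_zero n2 n3)))
  · exact ((hP.comp (d1 (fun x => 2 * x) (by fun_prop))).mul
      (hP.comp (d1 (fun x => -2 * x) (by fun_prop)))) x
  · refine (((hP.comp (d1 (fun x => k + 2 * x) (by fun_prop)))).mul (Differentiable.mul ?_
      (hP.comp (d2.mul_const _)))) x
    exact Differentiable.fun_finsetProd fun i _ => (d2.mul_const _).const_sub _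

theorem differentiableAt_gaussDelta (ha : 0 < a)
    (hpow : ∀ s : ℂ, q ^ s = Complex.exp (-(s / a))) {k x : ℂ} {ε : ℝ} (hk : 0 < k.re)
    (hε : |k.im| + 2 * ε < 2 * Real.pi * a) (hx : |x.im| ≤ ε) (hx0 : 0 ≤ x.re)
    (hxj : ∀ j : ℕ, x ≠ (k + j) / 2) : DifferentiableAt ℂ (gaussDelta q k) x := by
  have hq0 := ne_zero_of_cpow_eq_exp hpow
  have hq := norm_lt_one_of_cpow_eq_exp ha hpow
  rw [funext (gaussDelta_eq_reg_div hq0 hq k 0)]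
  refine (differentiableAt_gaussDeltaReg ha hpow hk hε hx hx0 0 fun j _ => hxj j).fun_div ?_
    (sub_ne_zero.2 (cpow_sub_mul_pow_ne_one ha hpow hε hx 0 (hxj 0)).symm)
  refine (((differentiable_const_cpow hq0).comp (f := fun x => k - 2 * x) (by fun_prop)).mul_const
    _).const_sub _ x

/-- The omitted factor e(x) = 1 - q^{k-2x+n} has a simple zero at p with e'(p) = -2/a, so the
residue is -(a/2) times the regular part. |Im k| < 2ε puts p inside the strip. -/
theorem rectIntegral_gaussDelta (ha : 0 < a)
    (hpow : ∀ s : ℂ, q ^ s = Complex.exp (-(s / a))) {k : ℂ} {ε : ℝ} (hk : 0 < k.re)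
    (hkε : |k.im| < 2 * ε) (hε : |k.im| + 2 * ε < 2 * Real.pi * a) (n : ℕ) {A B : ℝ} (hA : 0 ≤ A)
    (h1 : A < (k.re + n) / 2) (h2 : (k.re + n) / 2 < B)
    (hAB : ∀ j : ℕ, j ≠ n → (k.re + j) / 2 ∉ Set.Icc A B) :
    rectIntegral (gaussDelta q k) A B (-ε) ε =
      2 * Real.pi * Complex.I * (-(a / 2) * gaussDeltaReg q k n ((k + n) / 2)) := by
  have hq0 := ne_zero_of_cpow_eq_exp hpow
  have hq := norm_lt_one_of_cpow_eq_exp ha hpow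
  have ha' : (a : ℂ) ≠ 0 := by exact_mod_cast ha.ne'
  have hre : ∀ j : ℕ, ((k + j) / 2).re = (k.re + j) / 2 := fun j => by
    rw [show (2 : ℂ) = ((2 : ℝ) : ℂ) by norm_num, Complex.div_ofReal_re]; simp
  have him : ((k + n) / 2).im = k.im / 2 := by
    rw [show (2 : ℂ) = ((2 : ℝ) : ℂ) by norm_num, Complex.div_ofReal_im]; simp
  set p := (k + n) / 2 with hp
  set e : ℂ → ℂ := fun x => 1 - q ^ (k - 2 * x) * q ^ n with he
  have he' : ∀ x, HasDerivAt e (-(2 / a) * (q ^ (k - 2 * x) * q ^ n)) x := fun x => by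
    have h : HasDerivAt (fun x : ℂ => -((k - 2 * x) / a)) (2 / a) x := by
      have := ((((hasDerivAt_id x).const_mul 2).const_sub k).div_const (a : ℂ)).fun_neg
      simpa [neg_div] using this
    have h' := ((h.cexp.mul_const (q ^ n)).const_sub 1)
    simp_rw [← hpow] at h'
    exact h'.congr_deriv (by ring)
  have hed : Differentiable ℂ e := fun x => (he' x).differentiableAt
  have hqp : q ^ (k - 2 * p) * q ^ n = 1 := by
    rw [← cpow_natCast_add hq0, show (n : ℂ) + (k - 2 * p) = 0 by rw [hp]; ring, Complex.cpow_zero]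
  have hep : e p = 0 := by simp only [he]; rw [hqp, sub_self]
  have hEp : dslope e p p = -(2 / a) := by
    rw [dslope_same, (he' p).deriv, hqp, mul_one]
  have hEx : ∀ x, x ≠ p → dslope e p x = e x / (x - p) := fun x hx => by
    rw [dslope_of_ne _ hx, slope_def_field, hep, sub_zero]
  -- `dslope e p` is the entire function e(x)/(x - p), without zeros on the rectangle; the numerator
  -- over the simple pole is the regular part divided by it.
  have hEd : Differentiable ℂ (dslope e p) := by
    rw [← differentiableOn_univ]
    exact (Complex.differentiableOn_dslope univ_mem).2 hed.differentiableOn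
  have hE0 : ∀ x ∈ Set.Icc A B ×ℂ Set.Icc (-ε) ε, dslope e p x ≠ 0 := by
    intro x hx
    by_cases hxp : x = p
    · rw [hxp, hEp]
      exact neg_ne_zero.2 (div_ne_zero two_ne_zero ha')
    · rw [hEx x hxp]
      refine div_ne_zero (sub_ne_zero.2 ?_) (sub_ne_zero.2 hxp)
      exact (cpow_sub_mul_pow_ne_one ha hpow hε (abs_le.2 hx.2) n hxp).symm
  have hF : ∀ x ∈ Set.Icc A B ×ℂ Set.Icc (-ε) ε, DifferentiableAt ℂ (gaussDeltaReg q k n) x :=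
    fun x hx => differentiableAt_gaussDeltaReg ha hpow hk hε (abs_le.2 hx.2) (hA.trans hx.1.1) n
      fun j hj hxj => hAB j hj (by
        have := hx.1
        rw [Set.mem_preimage, hxj, hre] at this
        exact this)
  have hk2 := abs_lt.1 hkε
  rw [rectIntegral_eq_of_simple_pole (H := fun x => gaussDeltaReg q k n x / dslope e p x) (p := p)
    (by rw [hre]; exact h1) (by rw [hre]; exact h2) (by rw [him]; linarith) (by rw [him]; linarith)
    (fun x hx => (hF x hx).fun_div (hEd x) (hE0 x hx)) (fun x hx hxp => ?_)]
  · simp only [hEp]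
    field_simp
  · have : x - p ≠ 0 := sub_ne_zero.2 hxp
    rw [hEx x hxp, gaussDelta_eq_reg_div hq0 hq k n]
    simp only [he]
    field_simp

/-- At x = (k+n)/2 each symbol is one with argument free of n, up to a finite product. These finite
products assemble to the Jackson weight. -/
theorem gaussDeltaReg_at_pole (ha : 0 < a)
    (hpow : ∀ s : ℂ, q ^ s = Complex.exp (-(s / a))) {k : ℂ} (hk : 0 < k.re) (n : ℕ) :
    gaussDeltaReg q k n ((k + n) / 2) =
      qPoch q (q ^ k) * qPoch q (q ^ k)⁻¹ / (qPoch q ((q ^ k) ^ 2) * qPoch q q) *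
        (jacksonWeight q k n * q ^ (((k + n) / 2) ^ 2)) := by
  have hq0 := ne_zero_of_cpow_eq_exp hpow
  have hq := norm_lt_one_of_cpow_eq_exp ha hpow
  have ht := norm_cpow_lt_one_of_cpow_eq_exp ha hpow hk
  have ht1 : q ^ k ≠ 1 := fun h => by rw [h, norm_one] at ht; exact ht.false
  rw [jacksonWeight_eq q k ht1]
  have e1 : q ^ (2 * ((k + n) / 2)) = q ^ k * q ^ n := by
    rw [← cpow_natCast_add hq0]; ring_nf
  have e2 : q ^ (-2 * ((k + n) / 2)) = (q ^ k)⁻¹ * (q ^ n)⁻¹ := by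
    rw [← mul_inv, ← e1, ← Complex.cpow_neg]; ring_nf
  have e3 : q ^ (k + 2 * ((k + n) / 2)) = (q ^ k) ^ 2 * q ^ n := by
    rw [Complex.cpow_add _ _ hq0, e1]; ring
  have hn0 : q ^ n ≠ 0 := pow_ne_zero _ hq0
  have ht0 : q ^ k ≠ 0 := by simp [Complex.cpow_eq_zero_iff, hq0]
  have e4 : q ^ (k - 2 * ((k + n) / 2)) = (q ^ n)⁻¹ := by
    rw [Complex.cpow_sub _ _ hq0, e1]; field_simp
  have e5 : q ^ (-k * (n : ℂ)) = ((q ^ k)⁻¹) ^ n := by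
    rw [mul_comm, Complex.cpow_nat_mul, Complex.cpow_neg]
  have e6 : ∏ l ∈ Finset.Icc 1 n, (1 - q ^ ((l : ℂ) + 2 * k - 1)) / (1 - q ^ l) =
      (∏ i ∈ Finset.range n, (1 - (q ^ k) ^ 2 * q ^ i)) /
        ∏ i ∈ Finset.range n, (1 - q * q ^ i) := by
    rw [← Finset.prod_div_distrib, show Finset.Icc 1 n = Finset.Ico 1 (n + 1) from rfl,
      Finset.prod_Ico_eq_prod_range]
    refine Finset.prod_congr (by simp) fun i _ => ?_
    rw [show ((1 + i : ℕ) : ℂ) + 2 * k - 1 = (i : ℂ) + (2 : ℕ) * k by push_cast; ring,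
      cpow_natCast_add hq0, Complex.cpow_nat_mul]
    ring
  rw [gaussDeltaReg, e1, e2, e3, e4, e5, e6, cpow_natCast_add hq0]
  set t := q ^ k with ht_def
  have f1 : qPoch q t = (∏ i ∈ Finset.range n, (1 - t * q ^ i)) * qPoch q (t * q ^ n) :=
    qPoch_eq_prod_mul hq t n
  have f2 : qPoch q (t ^ 2) = (∏ i ∈ Finset.range n, (1 - t ^ 2 * q ^ i)) *
    qPoch q (t ^ 2 * q ^ n) := qPoch_eq_prod_mul hq _ n
  have f3 : qPoch q (t⁻¹ * (q ^ n)⁻¹) =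
      (∏ i ∈ Finset.range n, (1 - t⁻¹ * (q ^ n)⁻¹ * q ^ i)) * qPoch q t⁻¹ := by
    rw [qPoch_eq_prod_mul hq _ n, mul_assoc t⁻¹, inv_mul_cancel₀ hn0, mul_one]
  -- Reversing the order of a product with negative exponents. It is used for b = t and b = 1; the
  -- signs and powers of q cancel between the two, and t^{-n} = q^{-kn} is left.
  have refl : ∀ b : ℂ, b ≠ 0 → ∏ i ∈ Finset.range n, (1 - b⁻¹ * (q ^ n)⁻¹ * q ^ i) =
      (∏ i ∈ Finset.range n, (-(q * q ^ i)⁻¹)) * (b⁻¹) ^ n *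
        ∏ i ∈ Finset.range n, (1 - b * q * q ^ i) := by
    intro b hb
    rw [← Finset.prod_range_reflect, show (b⁻¹) ^ n = ∏ i ∈ Finset.range n, b⁻¹ by simp,
      ← Finset.prod_mul_distrib, ← Finset.prod_mul_distrib]
    refine Finset.prod_congr rfl fun i hi => ?_
    have hi' := Finset.mem_range.1 hi
    have : q ^ n = q ^ (n - 1 - i) * (q * q ^ i) := by
      rw [← pow_succ', ← pow_add]
      congr 1
      omega
    have h0 : q ^ (n - 1 - i) ≠ 0 := pow_ne_zero _ hq0
    have h1 : q ^ i ≠ 0 := pow_ne_zero _ hq0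
    rw [this]
    field_simp
    ring
  have f4 := refl t ht0
  have f5 := refl 1 one_ne_zero
  simp only [inv_one, one_mul, one_pow, mul_one] at f5
  have f6 : (1 - t) * ∏ i ∈ Finset.range n, (1 - t * q * q ^ i) =
      (∏ i ∈ Finset.range n, (1 - t * q ^ i)) * (1 - q ^ k * q ^ n) := by
    rw [← Finset.prod_range_succ, Finset.prod_range_succ', mul_comm]
    congr 1
    · exact Finset.prod_congr rfl fun i _ => by ring
    · simp
  have n1 : ∏ i ∈ Finset.range n, (-(q * q ^ i)⁻¹) ≠ 0 :=
    Finset.prod_ne_zero_iff.2 fun i _ => neg_ne_zero.2 (inv_ne_zero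
      (mul_ne_zero hq0 (pow_ne_zero _ hq0)))
  have n2 : ∏ i ∈ Finset.range n, (1 - q * q ^ i) ≠ 0 :=
    Finset.prod_ne_zero_iff.2 fun i _ => one_sub_q_mul_pow_ne_zero hq i
  have n3 : qPoch q (t ^ 2) ≠ 0 := qPoch_ne_zero_of_norm_lt_one hq (by
    rw [norm_pow]; exact pow_lt_one₀ (norm_nonneg _) ht two_ne_zero)
  have n4 : 1 - t ≠ 0 := one_sub_ne_zero_of_norm_lt ht
  have n5 := qPoch_ne_zero_of_norm_lt_one hq hq
  have f7 : (q ^ n)⁻¹ * q ^ (n + 1) = q := by rw [pow_succ, inv_mul_cancel_left₀ hn0]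
  rw [f7, f3, f4, f5]
  rw [f2] at n3 ⊢
  have n6 := left_ne_zero_of_mul n3
  have n7 := right_ne_zero_of_mul n3
  rw [f1]
  generalize ∏ i ∈ Finset.range n, (-(q * q ^ i)⁻¹) = X1 at *
  generalize ∏ i ∈ Finset.range n, (1 - q * q ^ i) = X2 at *
  generalize ∏ i ∈ Finset.range n, (1 - t ^ 2 * q ^ i) = X3 at *
  generalize ∏ i ∈ Finset.range n, (1 - t * q ^ i) = X4 at *
  generalize ∏ i ∈ Finset.range n, (1 - t * q * q ^ i) = X5 at *
  generalize qPoch q (t ^ 2 * q ^ n) = X6 at *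
  generalize qPoch q q = X7 at *
  generalize qPoch q (t * q ^ n) = X8 at *
  generalize qPoch q t⁻¹ = X9 at *
  generalize (t⁻¹) ^ n = X10 at *
  generalize q ^ (((k + n) / 2) ^ 2) = X11 at *
  field_simp
  linear_combination (X8 * X9 * X10 * X11) * f6

end Sharp

/-! ### Decay of the integrand under the shift x ↦ x + 1/2. -/

theorem norm_shift_iterate_le {E : Type*} [AddCommMonoid E] {g : E → ℂ} {S : Set E} {v : E}
    (hS : ∀ x ∈ S, x + v ∈ S) (h : ∀ x ∈ S, ‖g (x + v)‖ ≤ Real.exp (-(1 / 2)) * ‖g x‖) (m : ℕ)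
    {x : E} (hx : x ∈ S) : x + m • v ∈ S ∧ ‖g (x + m • v)‖ ≤ Real.exp (-(m / 2)) * ‖g x‖ := by
  induction m with
  | zero => simpa using hx
  | succ m ih =>
    rw [succ_nsmul, ← add_assoc]
    refine ⟨hS _ ih.1, (h _ ih.1).trans ?_⟩
    rw [show -(((m + 1 : ℕ) : ℝ) / 2) = -(1 / 2) + -(m / 2) by push_cast; ring, Real.exp_add,
      mul_assoc]
    gcongr
    exact ih.2

theorem integrableOn_Ioi_of_shift {g : ℝ → ℂ} {R : ℝ} (hc : ContinuousOn g (Set.Ici 0))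
    (hR : 0 ≤ R) (h : ∀ t, R ≤ t → ‖g (t + 1 / 2)‖ ≤ Real.exp (-(1 / 2)) * ‖g t‖) :
    MeasureTheory.IntegrableOn g (Set.Ioi 0) := by
  obtain ⟨M, hM⟩ := (isCompact_Icc (a := R) (b := R + 1 / 2)).exists_bound_of_continuousOn
    (hc.mono fun x hx => hR.trans hx.1)
  refine ((hc.locallyIntegrableOn measurableSet_Ici).integrableOn_of_isBigO_atTop
    (g := fun t => Real.exp (-1 * t)) (Asymptotics.IsBigO.of_bound (M * Real.exp (1 / 2 + R)) ?_)
    ⟨Set.Ioi 1, Ioi_mem_atTop 1, exp_neg_integrableOn_Ioi 1 one_pos⟩).mono_set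
    Set.Ioi_subset_Ici_self
  filter_upwards [eventually_ge_atTop R] with t ht
  -- t is m half-steps beyond a point of [R, R + 1/2], and m/2 > t - R - 1/2 turns the gain e^{-m/2}
  -- into O(e^{-t}).
  set m := ⌊2 * (t - R)⌋₊ with hm
  have h1 : (m : ℝ) ≤ 2 * (t - R) := Nat.floor_le (by linarith)
  have h2 : 2 * (t - R) < m + 1 := Nat.lt_floor_add_one _
  have h3 : t - m / 2 ∈ Set.Icc R (R + 1 / 2) := ⟨by linarith, by linarith⟩
  have h4 := (norm_shift_iterate_le (S := Set.Ici R) (v := (1 / 2 : ℝ)) (g := g)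
    (fun x hx => by simp only [Set.mem_Ici] at *; linarith) h m (Set.mem_Ici.2 h3.1)).2
  rw [show t - m / 2 + m • (1 / 2 : ℝ) = t by rw [nsmul_eq_mul]; ring] at h4
  have hM0 : 0 ≤ M := (norm_nonneg _).trans (hM _ h3)
  refine h4.trans ?_
  rw [Real.norm_of_nonneg (Real.exp_pos _).le, mul_assoc, ← Real.exp_add, mul_comm]
  refine mul_le_mul (hM _ h3) (Real.exp_le_exp.2 (by linarith)) (Real.exp_pos _).le hM0

theorem rectIntegral_add_adjacent {f : ℂ → ℂ} {a b e c d : ℝ}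
    (h1 : ContinuousOn (fun x : ℝ => f (x + c * Complex.I)) (Set.Ici 0))
    (h2 : ContinuousOn (fun x : ℝ => f (x + d * Complex.I)) (Set.Ici 0))
    (ha : 0 ≤ a) (hb : 0 ≤ b) (he : 0 ≤ e) :
    rectIntegral f a b c d + rectIntegral f b e c d = rectIntegral f a e c d := by
  have key : ∀ {g : ℝ → ℂ}, ContinuousOn g (Set.Ici 0) →
      (∫ x in a..b, g x) + (∫ x in b..e, g x) = ∫ x in a..e, g x := fun hg =>
    intervalIntegral.integral_add_adjacent_intervals
      (hg.mono fun x hx => (le_min ha hb).trans hx.1).intervalIntegrable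
      (hg.mono fun x hx => (le_min hb he).trans hx.1).intervalIntegrable
  rw [rectIntegral, rectIntegral, rectIntegral, ← key h1, ← key h2]
  ring

section Sharp

variable {q : ℂ} {a : ℝ}

/-- The shift multiplies q^{2x} by q, so each symbol gains or loses one factor, while the Gaussian
contributes the decaying q^{x+1/4}. Where q·q^{2x} = q^k, both sides are 0 by the convention for
division. -/
theorem gaussDelta_add_half (ha : 0 < a) (hpow : ∀ s : ℂ, q ^ s = Complex.exp (-(s / a))) {k x : ℂ}
    (hk : 0 < k.re) (hx : 0 < x.re) :
    gaussDelta q k (x + 1 / 2) = q ^ (x + 1 / 4) *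
      (((q * q ^ (2 * x) - 1) * (1 - q ^ k * q ^ (2 * x))) /
        ((1 - q ^ (2 * x)) * (q * q ^ (2 * x) - q ^ k))) * gaussDelta q k x := by
  have hq0 := ne_zero_of_cpow_eq_exp hpow
  have hq := norm_lt_one_of_cpow_eq_exp ha hpow
  have ht := norm_cpow_lt_one_of_cpow_eq_exp ha hpow hk
  have hz := norm_cpow_lt_one_of_cpow_eq_exp ha hpow (s := 2 * x) (by simpa using hx)
  have htz : ‖q ^ k * q ^ (2 * x)‖ < 1 := by
    rw [norm_mul]; exact mul_lt_one_of_nonneg_of_lt_one_left (norm_nonneg _) ht hz.le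
  have e0 : q ^ ((x + 1 / 2) ^ 2) = q ^ (x ^ 2) * q ^ (x + 1 / 4) := by
    rw [← Complex.cpow_add _ _ hq0]; ring_nf
  have e1 : q ^ (2 * (x + 1 / 2)) = q ^ (2 * x) * q := by
    rw [mul_add, Complex.cpow_add _ _ hq0]; norm_num
  have e2 : q ^ (-2 * (x + 1 / 2)) = (q ^ (2 * x) * q)⁻¹ := by
    rw [← e1, ← Complex.cpow_neg]; ring_nf
  have e3 : q ^ (k + 2 * (x + 1 / 2)) = q ^ k * q ^ (2 * x) * q := by
    rw [Complex.cpow_add _ _ hq0, e1, mul_assoc]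
  have e4 : q ^ (k - 2 * (x + 1 / 2)) = q ^ k * (q ^ (2 * x) * q)⁻¹ := by
    rw [Complex.cpow_sub _ _ hq0, e1, div_eq_mul_inv]
  have e5 : q ^ (-2 * x) = (q ^ (2 * x))⁻¹ := by rw [← Complex.cpow_neg]; ring_nf
  have e6 : q ^ (k + 2 * x) = q ^ k * q ^ (2 * x) := Complex.cpow_add _ _ hq0
  have e7 : q ^ (k - 2 * x) = q ^ k * (q ^ (2 * x))⁻¹ := by
    rw [Complex.cpow_sub _ _ hq0, div_eq_mul_inv]
  rw [gaussDelta, gaussDelta, qDelta_eq hq0 hq, qDelta_eq hq0 hq, e0, e1, e2, e3, e4, e5, e6, e7]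
  have hz0 : q ^ (2 * x) ≠ 0 := by simp [Complex.cpow_eq_zero_iff, hq0]
  have n1 := one_sub_ne_zero_of_norm_lt hz
  have n2 := one_sub_ne_zero_of_norm_lt htz
  generalize q ^ (2 * x) = z at *
  generalize q ^ k = t at *
  have f1 : (z * q)⁻¹ * q = z⁻¹ := by field_simp
  have f2 : t * (z * q)⁻¹ * q = t * z⁻¹ := by rw [mul_assoc, f1]
  rw [qPoch_succ hq z, qPoch_succ hq (z * q)⁻¹, f1, qPoch_succ hq (t * z),
    qPoch_succ hq (t * (z * q)⁻¹), f2]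
  have f3 : 1 - (z * q)⁻¹ = (q * z - 1) / (z * q) := by field_simp
  have f4 : 1 - t * (z * q)⁻¹ = (q * z - t) / (z * q) := by field_simp
  rw [f3, f4]
  generalize qPoch q (z * q) = A
  generalize qPoch q z⁻¹ = B
  generalize qPoch q (t * z * q) = C
  generalize qPoch q (t * z⁻¹) = D
  generalize q * z - t = w
  generalize q * z - 1 = w'
  generalize 1 - t * z = w'' at *
  field_simp

theorem exists_norm_gaussDelta_add_half_le (ha : 0 < a)
    (hpow : ∀ s : ℂ, q ^ s = Complex.exp (-(s / a))) {k : ℂ} (hk : 0 < k.re) :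
    ∃ R : ℝ, 0 < R ∧ ∀ x : ℂ, R ≤ x.re →
      ‖gaussDelta q k (x + 1 / 2)‖ ≤ Real.exp (-(1 / 2)) * ‖gaussDelta q k x‖ := by
  have hq0 := ne_zero_of_cpow_eq_exp hpow
  have hq := norm_lt_one_of_cpow_eq_exp ha hpow
  have ht := norm_cpow_lt_one_of_cpow_eq_exp ha hpow hk
  have ht0 : 0 < ‖q ^ k‖ := norm_pos_iff.2 (by simp [Complex.cpow_eq_zero_iff, hq0])
  have l1 : Tendsto (fun y : ℝ => Real.exp (-(2 * y / a))) atTop (𝓝 0) :=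
    Real.tendsto_exp_neg_atTop_nhds_zero.comp
      ((tendsto_id.const_mul_atTop two_pos).atTop_div_const ha)
  have l2 : Tendsto (fun y : ℝ => Real.exp (-((y + 1 / 4) / a))) atTop (𝓝 0) :=
    Real.tendsto_exp_neg_atTop_nhds_zero.comp
      ((tendsto_atTop_add_const_right _ _ tendsto_id).atTop_div_const ha)
  -- With |q^{2x}| this small the rational factor is at most 2·2 / ((1/2)(|q^k|/2)) = 16/|q^k|; the
  -- second condition compensates for it and leaves e^{-1/2}.
  have ev := (l1.eventually_lt_const (u := min (1 / 2) (‖q ^ k‖ / 2)) (by positivity)).and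
    (l2.eventually_lt_const (u := Real.exp (-(1 / 2)) * ‖q ^ k‖ / 16) (by positivity))
  obtain ⟨R, hR⟩ := eventually_atTop.1 ev
  refine ⟨max R 1, by positivity, fun x hx => ?_⟩
  obtain ⟨h1, h2⟩ := hR x.re ((le_max_left _ _).trans hx)
  rw [gaussDelta_add_half ha hpow hk (one_pos.trans_le ((le_max_right _ _).trans hx)), norm_mul]
  refine mul_le_mul_of_nonneg_right ?_ (norm_nonneg _)
  have hz : ‖q ^ (2 * x)‖ < min (1 / 2) (‖q ^ k‖ / 2) := by
    rw [norm_cpow_of_cpow_eq_exp hpow]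
    simpa using h1
  have hz1 := hz.trans_le (min_le_left _ _)
  have hz2 := hz.trans_le (min_le_right _ _)
  have hA : ‖q ^ (x + 1 / 4)‖ ≤ Real.exp (-(1 / 2)) * ‖q ^ k‖ / 16 := by
    rw [norm_cpow_of_cpow_eq_exp hpow]
    refine le_trans (le_of_eq ?_) h2.le
    norm_num
  have hqz : ‖q * q ^ (2 * x)‖ ≤ ‖q ^ (2 * x)‖ := by
    rw [norm_mul]; exact mul_le_of_le_one_left (norm_nonneg _) hq.le
  have htz : ‖q ^ k * q ^ (2 * x)‖ ≤ ‖q ^ (2 * x)‖ := by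
    rw [norm_mul]; exact mul_le_of_le_one_left (norm_nonneg _) ht.le
  have b1 : ‖q * q ^ (2 * x) - 1‖ ≤ 2 := by
    have := norm_sub_le (q * q ^ (2 * x)) 1
    rw [norm_one] at this
    linarith
  have b2 : ‖1 - q ^ k * q ^ (2 * x)‖ ≤ 2 := by
    have := norm_sub_le 1 (q ^ k * q ^ (2 * x))
    rw [norm_one] at this
    linarith
  have b3 : 1 / 2 ≤ ‖1 - q ^ (2 * x)‖ := by
    have := norm_sub_norm_le 1 (q ^ (2 * x))
    rw [norm_one] at this
    linarith
  have b4 : ‖q ^ k‖ / 2 ≤ ‖q * q ^ (2 * x) - q ^ k‖ := by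
    have := norm_sub_norm_le (q ^ k) (q * q ^ (2 * x))
    rw [norm_sub_rev] at this
    linarith
  rw [norm_mul, norm_div, norm_mul, norm_mul]
  calc _ ≤ Real.exp (-(1 / 2)) * ‖q ^ k‖ / 16 * (2 * 2 / (1 / 2 * (‖q ^ k‖ / 2))) := by gcongr
    _ = Real.exp (-(1 / 2)) := by field_simp; norm_num

theorem continuousOn_gaussDelta_horizontal (ha : 0 < a)
    (hpow : ∀ s : ℂ, q ^ s = Complex.exp (-(s / a))) {k : ℂ} {ε : ℝ} (hk : 0 < k.re)
    (hε : |k.im| + 2 * ε < 2 * Real.pi * a) {y : ℝ} (hy : |y| ≤ ε) (hyk : 2 * y ≠ k.im) :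
    ContinuousOn (fun x : ℝ => gaussDelta q k (x + y * Complex.I)) (Set.Ici 0) := by
  intro x hx
  have h : DifferentiableAt ℂ (gaussDelta q k) (x + y * Complex.I) :=
    differentiableAt_gaussDelta ha hpow hk hε (by simpa using hy) (by simpa using hx)
      fun j hj => hyk (by
        have := congrArg Complex.im hj
        rw [show (2 : ℂ) = ((2 : ℝ) : ℂ) by norm_num, Complex.div_ofReal_im] at this
        simp at this
        linarith)
  exact (ContinuousAt.comp (f := fun x : ℝ => (x : ℂ) + y * Complex.I) h.continuousAt
    (by fun_prop)).continuousWithinAt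

theorem continuousOn_gaussDelta_vertical (ha : 0 < a)
    (hpow : ∀ s : ℂ, q ^ s = Complex.exp (-(s / a))) {k : ℂ} {ε : ℝ} (hk : 0 < k.re)
    (hε : |k.im| + 2 * ε < 2 * Real.pi * a) {x : ℝ} (hx : 0 ≤ x)
    (hxk : ∀ j : ℕ, x ≠ (k.re + j) / 2) :
    ContinuousOn (fun y : ℝ => gaussDelta q k (x + y * Complex.I)) (Set.Icc (-ε) ε) := by
  intro y hy
  have h : DifferentiableAt ℂ (gaussDelta q k) (x + y * Complex.I) :=
    differentiableAt_gaussDelta ha hpow hk hε (by simpa using abs_le.2 hy) (by simpa using hx)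
      fun j hj => hxk j (by
        have := congrArg Complex.re hj
        rw [show (2 : ℂ) = ((2 : ℝ) : ℂ) by norm_num, Complex.div_ofReal_re] at this
        simpa using this)
  exact (ContinuousAt.comp (f := fun y : ℝ => (x : ℂ) + y * Complex.I) h.continuousAt
    (by fun_prop)).continuousWithinAt

theorem integrableOn_gaussDelta_horizontal (ha : 0 < a)
    (hpow : ∀ s : ℂ, q ^ s = Complex.exp (-(s / a))) {k : ℂ} {ε : ℝ} (hk : 0 < k.re)
    (hε : |k.im| + 2 * ε < 2 * Real.pi * a) {y : ℝ} (hy : |y| ≤ ε) (hyk : 2 * y ≠ k.im) :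
    MeasureTheory.IntegrableOn (fun x : ℝ => gaussDelta q k (x + y * Complex.I)) (Set.Ioi 0) := by
  obtain ⟨R, hR0, hR⟩ := exists_norm_gaussDelta_add_half_le ha hpow hk
  refine integrableOn_Ioi_of_shift (continuousOn_gaussDelta_horizontal ha hpow hk hε hy hyk) hR0.le
    fun x hx => ?_
  have := hR (x + y * Complex.I) (by simpa using hx)
  rwa [show (x : ℂ) + y * Complex.I + 1 / 2 = ((x + 1 / 2 : ℝ) : ℂ) + y * Complex.I by
    push_cast; ring] at this

/-! ### Exhausting the half-strip by rectangles. -/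

/-- The abscissae that separate the poles `(k + n) / 2`. -/
noncomputable def poleSeparator (k : ℂ) (n : ℕ) : ℝ := if n = 0 then 0 else k.re / 2 + n / 2 - 1 / 4

theorem poleSeparator_nonneg {k : ℂ} (hk : 0 < k.re) (n : ℕ) : 0 ≤ poleSeparator k n := by
  rw [poleSeparator]
  split_ifs with h
  · exact le_rfl
  · have : (1 : ℝ) ≤ n := by exact_mod_cast Nat.one_le_iff_ne_zero.2 h
    linarith

theorem poleSeparator_lt {k : ℂ} (hk : 0 < k.re) {n j : ℕ} (h : n ≤ j) :
    poleSeparator k n < (k.re + j) / 2 := by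
  have : (n : ℝ) ≤ j := by exact_mod_cast h
  have : (0 : ℝ) ≤ j := Nat.cast_nonneg j
  rw [poleSeparator]
  split_ifs <;> linarith

theorem lt_poleSeparator {k : ℂ} {n j : ℕ} (h : j < n) : (k.re + j) / 2 < poleSeparator k n := by
  have : (j : ℝ) + 1 ≤ n := by exact_mod_cast h
  rw [poleSeparator, if_neg (by omega)]
  linarith

theorem poleSeparator_ne {k : ℂ} (hk : 0 < k.re) (n j : ℕ) :
    poleSeparator k n ≠ (k.re + j) / 2 := by
  rcases le_or_gt n j with h | h
  · exact (poleSeparator_lt hk h).ne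
  · exact (lt_poleSeparator h).ne'

theorem tendsto_poleSeparator (k : ℂ) : Tendsto (poleSeparator k) atTop atTop := by
  have h : Tendsto (fun n : ℕ => k.re / 2 + (n : ℝ) / 2 - 1 / 4) atTop atTop :=
    tendsto_atTop_add_const_right _ _ (tendsto_atTop_add_const_left _ _
      (tendsto_natCast_atTop_atTop.atTop_div_const two_pos))
  refine h.congr' ?_
  filter_upwards [eventually_ne_atTop 0] with n hn
  rw [poleSeparator, if_neg hn]

/-- Consecutive separators bound rectangles with exactly one pole each, and the shared vertical
sides cancel. -/
theorem rectIntegral_gaussDelta_eq_sum (ha : 0 < a)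
    (hpow : ∀ s : ℂ, q ^ s = Complex.exp (-(s / a))) {k : ℂ} {ε : ℝ} (hk : 0 < k.re)
    (hkε : |k.im| < 2 * ε) (hε : |k.im| + 2 * ε < 2 * Real.pi * a) (N : ℕ) :
    rectIntegral (gaussDelta q k) 0 (poleSeparator k N) (-ε) ε =
      ∑ n ∈ Finset.range N,
        2 * Real.pi * Complex.I * (-(a / 2) * gaussDeltaReg q k n ((k + n) / 2)) := by
  have hε0 : 0 < ε := by have := abs_nonneg k.im; linarith
  have hk2 := abs_lt.1 hkε
  have c1 := continuousOn_gaussDelta_horizontal ha hpow hk hε (y := ε) (abs_of_pos hε0).le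
    (by linarith)
  have c2 := continuousOn_gaussDelta_horizontal ha hpow hk hε (y := -ε)
    (by rw [abs_neg, abs_of_pos hε0]) (by linarith)
  induction N with
  | zero => simp [poleSeparator, rectIntegral]
  | succ N ih =>
    rw [Finset.sum_range_succ, ← ih, ← rectIntegral_add_adjacent c2 c1 le_rfl
      (poleSeparator_nonneg hk N) (poleSeparator_nonneg hk (N + 1)),
      rectIntegral_gaussDelta ha hpow hk hkε hε N (poleSeparator_nonneg hk N)
        (poleSeparator_lt hk le_rfl) (lt_poleSeparator N.lt_succ_self)]
    intro j hj hj'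
    rcases lt_or_gt_of_ne hj with h | h
    · exact (lt_poleSeparator h).not_ge hj'.1
    · exact (poleSeparator_lt hk h).not_ge hj'.2

theorem tendsto_vertical_gaussDelta (ha : 0 < a)
    (hpow : ∀ s : ℂ, q ^ s = Complex.exp (-(s / a))) {k : ℂ} {ε : ℝ} (hk : 0 < k.re)
    (hε0 : 0 < ε) (hε : |k.im| + 2 * ε < 2 * Real.pi * a) :
    Tendsto (fun N : ℕ => ∫ y : ℝ in (-ε)..ε, gaussDelta q k (poleSeparator k N + y * Complex.I))
      atTop (𝓝 0) := by
  obtain ⟨R, hR0, hR⟩ := exists_norm_gaussDelta_add_half_le ha hpow hk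
  obtain ⟨n, hn, hn0⟩ := (((tendsto_poleSeparator k).eventually_ge_atTop R).and
    (eventually_ne_atTop 0)).exists
  obtain ⟨M, hM⟩ := (isCompact_Icc (a := -ε) (b := ε)).exists_bound_of_continuousOn
    (continuousOn_gaussDelta_vertical ha hpow hk hε (poleSeparator_nonneg hk n)
      (poleSeparator_ne hk n))
  rw [← tendsto_add_atTop_iff_nat n]
  have hlim : Tendsto (fun m : ℕ => Real.exp (-((m : ℝ) / 2)) * M * |ε - -ε|) atTop (𝓝 0) := by
    simpa using ((Real.tendsto_exp_neg_atTop_nhds_zero.comp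
      (tendsto_natCast_atTop_atTop.atTop_div_const two_pos)).mul_const M).mul_const |ε - -ε|
  refine squeeze_zero_norm (fun m => ?_) hlim
  refine intervalIntegral.norm_integral_le_of_norm_le_const fun y hy => ?_
  rw [Set.uIoc_of_le (by linarith)] at hy
  have h1 := (norm_shift_iterate_le (S := {x : ℂ | R ≤ x.re}) (v := (1 / 2 : ℂ))
    (g := gaussDelta q k) (fun x hx => by
      have hx' : R ≤ x.re := hx
      have : (x + 1 / 2).re = x.re + 1 / 2 := by simp
      change R ≤ (x + 1 / 2).re
      linarith) hR m (x := poleSeparator k n + y * Complex.I) (by simpa using hn)).2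
  -- Separators of positive index are spaced by exactly 1/2, so far vertical sides are iterated
  -- shifts of one fixed side that avoids the poles.
  have e : (poleSeparator k (m + n) : ℂ) + y * Complex.I =
      poleSeparator k n + y * Complex.I + m • (1 / 2 : ℂ) := by
    rw [poleSeparator, poleSeparator, if_neg hn0, if_neg (by omega), nsmul_eq_mul]
    push_cast
    ring
  rw [e]
  refine h1.trans ?_
  gcongr
  exact hM y ⟨hy.1.le, hy.2⟩

/-- When the right side of the rectangle recedes to infinity, the other three sides, run
counterclockwise, form the sharp contour. The constant arises as (1/(2i)) · 2πi · (-a/2) = -aπ/2. -/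
theorem sharpIntegral_gaussDelta (ha : 0 < a)
    (hpow : ∀ s : ℂ, q ^ s = Complex.exp (-(s / a))) {k : ℂ} {ε : ℝ} (hk : 0 < k.re)
    (hkε : |k.im| < 2 * ε) (hε : |k.im| + 2 * ε < 2 * Real.pi * a) :
    SharpIntegrable ε (gaussDelta q k) ∧
      1 / (2 * Complex.I) * sharpIntegral ε (gaussDelta q k) =
        -(a * Real.pi / 2 : ℂ) *
          (∏' j : ℕ, ((1 - q ^ ((j : ℂ) + k)) * (1 - q ^ ((j : ℂ) - k))) /
            ((1 - q ^ ((j : ℂ) + 2 * k)) * (1 - q ^ ((j : ℂ) + 1)))) *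
          jacksonSum q k (fun x => q ^ (x ^ 2)) := by
  have hq0 := ne_zero_of_cpow_eq_exp hpow
  have hq := norm_lt_one_of_cpow_eq_exp ha hpow
  have hε0 : 0 < ε := by have := abs_nonneg k.im; linarith
  have hk2 := abs_lt.1 hkε
  have i1 := integrableOn_gaussDelta_horizontal ha hpow hk hε (y := ε) (abs_of_pos hε0).le
    (by linarith)
  have i2 := integrableOn_gaussDelta_horizontal ha hpow hk hε (y := -ε)
    (by rw [abs_neg, abs_of_pos hε0]) (by linarith)
  have i3 := continuousOn_gaussDelta_vertical ha hpow hk hε (x := 0) le_rfl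
    fun j => by positivity
  have i4 : IntervalIntegrable (fun s : ℝ => gaussDelta q k (-s * Complex.I) * (-Complex.I))
      MeasureTheory.volume (-ε) ε := by
    refine ContinuousOn.intervalIntegrable (ContinuousOn.mul ?_ continuousOn_const)
    rw [Set.uIcc_of_le (by linarith)]
    refine (i3.comp continuous_neg.continuousOn fun s hs => ⟨by linarith [hs.2], by
      linarith [hs.1]⟩).congr fun s _ => ?_
    simp
  have em : ∀ t : ℝ, (t : ℂ) + ((-ε : ℝ) : ℂ) * Complex.I = t - ε * Complex.I := fun t => by
    push_cast; ring
  have i2' := i2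
  simp_rw [em] at i2'
  refine ⟨⟨i1, i4, i2'⟩, ?_⟩
  have hlim1 := (((MeasureTheory.intervalIntegral_tendsto_integral_Ioi 0 i2
    (tendsto_poleSeparator k)).sub (MeasureTheory.intervalIntegral_tendsto_integral_Ioi 0 i1
    (tendsto_poleSeparator k))).add
    ((tendsto_vertical_gaussDelta ha hpow hk hε0 hε).const_mul Complex.I)).sub_const
      (Complex.I * ∫ y : ℝ in (-ε)..ε, gaussDelta q k ((0 : ℝ) + y * Complex.I))
  have hsum := (jacksonSum_gauss_evaluation hq0 hq k).1.hasSum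
  have hlim2 := (hsum.mul_left (2 * Real.pi * Complex.I * (-(a / 2) *
    (qPoch q (q ^ k) * qPoch q (q ^ k)⁻¹ / (qPoch q ((q ^ k) ^ 2) * qPoch q q))))).tendsto_sum_nat
  have hrect : ∀ N, rectIntegral (gaussDelta q k) 0 (poleSeparator k N) (-ε) ε = _ :=
    fun N => (rectIntegral_gaussDelta_eq_sum ha hpow hk hkε hε N).trans
      (Finset.sum_congr rfl fun n _ => by
        rw [gaussDeltaReg_at_pole ha hpow hk, ← mul_assoc (-(a / 2 : ℂ)), ← mul_assoc])
  have hval := tendsto_nhds_unique (hlim1.congr hrect) hlim2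
  have hsharp : sharpIntegral ε (gaussDelta q k) = _ := Eq.trans ?_ hval
  · rw [hsharp, jacksonSum]
    have e : ∏' j : ℕ, ((1 - q ^ ((j : ℂ) + k)) * (1 - q ^ ((j : ℂ) - k))) /
        ((1 - q ^ ((j : ℂ) + 2 * k)) * (1 - q ^ ((j : ℂ) + 1))) =
        qPoch q (q ^ k) * qPoch q (q ^ k)⁻¹ / (qPoch q ((q ^ k) ^ 2) * qPoch q q) := by
      rw [← tprod_four_div hq]
      refine tprod_congr fun j => ?_
      rw [sub_eq_add_neg (j : ℂ) k, cpow_natCast_add hq0, cpow_natCast_add hq0, cpow_natCast_add hq0,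
        cpow_natCast_add hq0, Complex.cpow_neg, Complex.cpow_one, show (2 : ℂ) = (2 : ℕ) by norm_num,
        Complex.cpow_nat_mul]
    rw [e]
    have := Complex.I_ne_zero
    field_simp
  · have hs : ∫ s : ℝ in (-ε)..ε, gaussDelta q k (-s * Complex.I) * (-Complex.I) =
        -(Complex.I * ∫ y : ℝ in (-ε)..ε, gaussDelta q k ((0 : ℝ) + y * Complex.I)) := by
      have := intervalIntegral.integral_comp_neg (a := -ε) (b := ε)
        (fun y : ℝ => gaussDelta q k ((0 : ℝ) + y * Complex.I))
      rw [neg_neg] at this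
      rw [intervalIntegral.integral_mul_const, ← this]
      simp [mul_comm]
    rw [sharpIntegral, hs]
    simp_rw [em]
    ring

end Sharp

theorem mainTheorem2 :
    -- the integral along the imaginary axis
    (∀ (q : ℝ) (a : ℝ) (k : ℂ), 0 < q → q < 1 → 0 < a → q = Real.exp (-1 / a) → 0 < k.re →
      MeasureTheory.Integrable (fun y : ℝ =>
        (q : ℂ) ^ (-(y * Complex.I) ^ 2) * qDelta q k (y * Complex.I)) ∧
      (-Complex.I) * imaginaryIntegral (fun x => (q : ℂ) ^ (-x ^ 2) * qDelta q k x) =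
        2 * (Real.sqrt (a * Real.pi) : ℂ) *
          ∏' j : ℕ, (1 - (q : ℂ) ^ ((j : ℂ) + k)) / (1 - (q : ℂ) ^ ((j : ℂ) + 2 * k))) ∧
    -- its constant term form
    (∀ q k : ℂ, 0 < ‖q‖ → ‖q‖ < 1 → ‖q ^ (1 + 2 * k)‖ < 1 →
      HasConstTerm q (muDomain q k) (fun x => invGaussSeries q x * qMu q k x)
        (∏' j : ℕ, (1 - q ^ ((j : ℂ) + 1 + k)) / (1 - q ^ ((j : ℂ) + 1 + 2 * k)))) ∧
    -- the integral along the sharp contour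
    (∀ (q : ℝ) (a : ℝ) (k : ℂ) (ε : ℝ), 0 < q → q < 1 → 0 < a → q = Real.exp (-1 / a) →
      0 < k.re → 0 < ε → |k.im| < 2 * ε → |k.im| + 2 * ε < 2 * Real.pi * a →
      SharpIntegrable ε (fun x => (q : ℂ) ^ (x ^ 2) * qDelta q k x) ∧
      1 / (2 * Complex.I) * sharpIntegral ε (fun x => (q : ℂ) ^ (x ^ 2) * qDelta q k x) =
        -(a * Real.pi / 2 : ℂ) *
          (∏' j : ℕ, ((1 - (q : ℂ) ^ ((j : ℂ) + k)) * (1 - (q : ℂ) ^ ((j : ℂ) - k))) /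
            ((1 - (q : ℂ) ^ ((j : ℂ) + 2 * k)) * (1 - (q : ℂ) ^ ((j : ℂ) + 1)))) *
          jacksonSum q k (fun x => (q : ℂ) ^ (x ^ 2))) ∧
    -- the evaluation of the Jackson sum
    (∀ (q : ℝ) (k : ℂ), 0 < q → q < 1 →
      Summable (fun j : ℕ => jacksonWeight q k j * (q : ℂ) ^ (((k + j) / 2) ^ 2)) ∧
      Summable (fun j : ℤ => (q : ℂ) ^ ((k + j) ^ 2 / 4)) ∧
      jacksonSum q k (fun x => (q : ℂ) ^ (x ^ 2)) =
        (∏' j : ℕ, (1 - (q : ℂ) ^ ((j : ℂ) + 1 + k)) / (1 - (q : ℂ) ^ ((j : ℂ) + 1))) *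
          ∑' j : ℤ, (q : ℂ) ^ ((k + j) ^ 2 / 4) ∧
      jacksonSum q k (fun x => (q : ℂ) ^ (x ^ 2)) =
        (q : ℂ) ^ (k ^ 2 / 4) *
          ∏' j : ℕ, ((1 - (q : ℂ) ^ (((j : ℂ) + 1) / 2)) * (1 - (q : ℂ) ^ ((j : ℂ) + 1 + k)) *
            (1 + (q : ℂ) ^ (((j : ℂ) + 1) / 2 - 1 / 4 + k / 2)) *
            (1 + (q : ℂ) ^ (((j : ℂ) + 1) / 2 - 1 / 4 - k / 2))) /
            (1 - (q : ℂ) ^ ((j : ℂ) + 1))) := by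
  refine ⟨fun q a k hq0 hq1 ha hqa hk => imaginaryIntegral_gauss_mul_qDelta hq0 hq1 ha hqa hk,
    fun q k hq0 hq1 hk => hasConstTerm_invGaussSeries_mul_qMu (norm_pos_iff.1 hq0) hq1 hk,
    fun q a k ε hq0 hq1 ha hqa hk hε hkε hε' => ?_, fun q k hq0 hq1 => ?_⟩
  -- The contour argument uses q = e^{-1/a} only through q^s = e^{-s/a}.
  · exact sharpIntegral_gaussDelta ha (fun s => by rw [hqa]; exact ofReal_exp_cpow a s) hk hkε hε'
  · exact jacksonSum_gauss_evaluation (by exact_mod_cast hq0.ne')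
      (by rwa [Complex.norm_real, Real.norm_of_nonneg hq0.le]) k
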